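/- Let $P_1,\dots,P_N$ be probability measures on $\mathbb{R}^d$ with finite supports, $|P_i|=|\operatorname{supp}(P_i)|$, and let $\lambda_1,\dots,\lambda_N>0$ with $\sum_{i=1}^N\lambda_i=1$. Write $\operatorname{supp}(P_i)=\{x_{ik}: k\le |P_i|\}$, let $d_{ik}$ be the mass of $x_{ik}$, and let $$S=\Big\{\sum_{i=1}^N\lambda_i x_i : x_i\in\operatorname{supp}(P_i)\Big\},\qquad S_{\rm org}=\bigcup_{i=1}^N\operatorname{supp}(P_i),\qquad \phi(P)=\sum_{i=1}^N\lambda_i W_2(P,P_i)^2 .$$ A barycenter $\bar P$ is a minimizer of $\phi$ over all probability measures on $\mathbb{R}^d$ with finite second moment. For a finite set $S_0\subset\mathbb{R}^d$, an approximate barycenter in $S_0$ is a minimizer of $\phi$ over all probability measures supported in $S_0$. A transport from a finitely supported probability measure $Q=\sum_j d_j\delta_{x_j}$ to $P_1,\dots,P_N$ is a family $y_{ijk}\ge 0$ with $\sum_k y_{ijk}=d_j$ and $\sum_j y_{ijk}=d_{ik}$. It is optimal if it has minimal cost $\sum_i\lambda_i\sum_{j,k}\|x_j-x_{ik}\|^2y_{ijk}$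 among all transports from $Q$. It is non-mass splitting if for all $i$ and all $x_j\in\operatorname{supp}(Q)$ there is exactly one $k$ with $y_{ijk}=d_j$, and $y_{ijk'}=0$ for $k'\neq k$. **Algorithm 1** (for a finite set $S_0=\{x_j\}$). Compute an optimal vertex $(z,y)$ of the linear program that minimizes $\sum_i\lambda_i\sum_{j,k}\|x_j-x_{ik}\|^2y_{ijk}$ subject to $\sum_k y_{ijk}=z_j$ for all $i,j$, $\sum_j y_{ijk}=d_{ik}$ for all $i,k$, and $y_{ijk}\ge0$. It represents the measure $\sum_j z_j\delta_{x_j}$. **Algorithm 2** (for an output $(z,y)$ of Algorithm 1). 1. Enumerate the points $x_j$ with $z_j>0$ as $s_1,\dots,s_r$, with masses $d_1,\dots,d_r$. For $l\le r$ and $i\le N$ let $P_i^l$ be the partial measure that gives $x_{ik}$ the mass that $y$ transports from $s_l$ to $x_{ik}$. A support point of $P_i^l$ is always a point of positive current mass. 2. For $l=r$ descending to $1$ and for $j=1$ ascending to $l-1$, repeat the following while $d_l>0$: for each $i$ choose a support point $x_i$ of $P_i^l$ that maximizes $(s_j-s_l)^Tx_i$, and put $c=\sum_i\lambda_i x_i$.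 If $\|c-s_j\|^2\ne\|c-s_l\|^2$, go on to the next pair $(l,j)$. Otherwise let $d_{\min}$ be the minimum over $i$ of the masses of $x_i$ in $P_i^l$, and move mass $d_{\min}$ from $d_l$ to $d_j$ and, for each $i$, at the point $x_i$ from $P_i^l$ to $P_i^j$. 3. For $l=1,\dots,r$ start with $\bar P^l=0$ and repeat the following while $d_l>0$: for each $i$ let $x_i$ be the lexicographically maximal support point of $P_i^l$, put $c=\sum_i\lambda_ix_i$, let $d_{\min}$ be the minimum over $i$ of the masses of $x_i$ in $P_i^l$, reduce by $d_{\min}$ both $d_l$ and, for each $i$, the mass of $x_i$ in $P_i^l$, and add mass $d_{\min}$ at $c$ to $\bar P^l$. 4. Return $\bar P'=\sum_l\bar P^l$. **Algorithm 3.** Start with $S_0=S_{\rm org}$. (i) Run Algorithm 1 for $S_0$; let $(z,y)$ be its output and $\bar P_{\rm org}$ the measure that it represents. (ii) Run Algorithm 2 for $(z,y)$ to find $\bar P'$. If $\bar P'\neq\bar P_{\rm org}$, set $S_0=\operatorname{supp}(\bar P')$ and go back to (i); otherwise return $\bar P'$. **Theorem.** Algorithm 3 terminates after finitely many steps, whichever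 optimal vertices, enumerations and maximizers are chosen. Every measure $\bar P'$ that it can return is a probability measure and has the following properties: $\bar P'$ is an approximate barycenter in the set $S_0$ of the last iteration; $\operatorname{supp}(\bar P')\subseteq S$; $\phi(\bar P')\le 2\,\phi(\bar P)$ for every barycenter $\bar P$; there is a non-mass splitting optimal transport from $\bar P'$ to $P_1,\dots,P_N$, whose cost is $\phi(\bar P')$, so that it realizes this bound; and $|\bar P'|\le\sum_{i=1}^N|P_i|-N+1$. -/

import Mathlib

open MeasureTheory
open scoped ENNReal BigOperators

noncomputable section

namespace DiscreteBarycenter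

/-- The Euclidean space `ℝ^d`. -/
abbrev E (d : ℕ) : Type := EuclideanSpace ℝ (Fin d)

/-! ### Discrete measures, Wasserstein distance, barycenters -/

/-- A discrete probability measure on `ℝ^d`: finitely many support points with positive mass,
of total mass `1`. -/
structure DiscreteMeasure (d : ℕ) where
  mass : E d →₀ ℝ
  nonneg : ∀ x, 0 ≤ mass x
  total : ∑ x ∈ mass.support, mass x = 1

/-- The support; its cardinality is the size `|P|`. -/
def DiscreteMeasure.supp {d : ℕ} (P : DiscreteMeasure d) : Finset (E d) := P.mass.support

/-- A discrete measure as a Borel measure on `ℝ^d`. -/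
def DiscreteMeasure.toMeasure {d : ℕ} (P : DiscreteMeasure d) : Measure (E d) :=
  ∑ x ∈ P.supp, ENNReal.ofReal (P.mass x) • Measure.dirac x

/-- The 2-Wasserstein distance: the square root of the infimum over all couplings of the
expected squared Euclidean distance. -/
def W2 {d : ℕ} (μ ν : Measure (E d)) : ℝ≥0∞ :=
  (⨅ (π : Measure (E d × E d)) (_ : π.fst = μ ∧ π.snd = ν),
    ∫⁻ p, edist p.1 p.2 ^ 2 ∂π) ^ (1 / 2 : ℝ)

/-- The objective `φ(μ) = ∑ i, λ_i W₂(μ, P_i)²`. -/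
def phi {N d : ℕ} (P : Fin N → DiscreteMeasure d) (lam : Fin N → ℝ) (μ : Measure (E d)) : ℝ≥0∞ :=
  ∑ i, ENNReal.ofReal (lam i) * W2 μ (P i).toMeasure ^ 2

/-- Borel probability measures on `ℝ^d` with finite second moment. -/
def FiniteSecondMoment {d : ℕ} (μ : Measure (E d)) : Prop :=
  IsProbabilityMeasure μ ∧ ∫⁻ x, ‖x‖ₑ ^ 2 ∂μ < ∞

/-- `μ` is a (Wasserstein) barycenter: it minimizes `φ` over all probability measures with finite
second moment. -/
def IsBarycenter {N d : ℕ} (P : Fin N → DiscreteMeasure d) (lam : Fin N → ℝ)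
    (μ : Measure (E d)) : Prop :=
  FiniteSecondMoment μ ∧ ∀ ν : Measure (E d), FiniteSecondMoment ν → phi P lam μ ≤ phi P lam ν

/-- `Q` is an approximate barycenter in the finite set `S₀`: it minimizes `φ` over the measures
supported in `S₀`. -/
def IsApproxBarycenter {N d : ℕ} (P : Fin N → DiscreteMeasure d) (lam : Fin N → ℝ)
    (S₀ : Finset (E d)) (Q : DiscreteMeasure d) : Prop :=
  Q.supp ⊆ S₀ ∧ ∀ Q' : DiscreteMeasure d, Q'.supp ⊆ S₀ →
    phi P lam Q.toMeasure ≤ phi P lam Q'.toMeasure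

/-- The set `S` of all weighted centroids of support points, one from each measure. -/
def centroidSet {N d : ℕ} (P : Fin N → DiscreteMeasure d) (lam : Fin N → ℝ) : Set (E d) :=
  {c | ∃ x : Fin N → E d, (∀ i, x i ∈ (P i).supp) ∧ c = ∑ i, lam i • x i}

open Classical in
/-- The union of the supports of the measures. -/
def unionSupp {N d : ℕ} (P : Fin N → DiscreteMeasure d) : Finset (E d) :=
  Finset.univ.biUnion fun i => (P i).supp

/-! ### Transports and the linear program over a set of possible support points -/

/-- Transport variables `y_{ijk}`, with `j` in a finite set `S₀` and `k` in the support of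
`P_i`. -/
abbrev Plan {N d : ℕ} (P : Fin N → DiscreteMeasure d) (S₀ : Finset (E d)) : Type :=
  (i : Fin N) → S₀ → (P i).supp → ℝ

/-- The cost `∑ i, λ_i ∑ j, ∑ k, ‖x_j - x_{ik}‖² y_{ijk}`. -/
def cost {N d : ℕ} {P : Fin N → DiscreteMeasure d} {S₀ : Finset (E d)} (lam : Fin N → ℝ)
    (y : Plan P S₀) : ℝ :=
  ∑ i, lam i * ∑ j : S₀, ∑ k : (P i).supp, ‖(j : E d) - (k : E d)‖ ^ 2 * y i j k

/-- `y` is a transport from `Q` to the measures `P_1, …, P_N`. -/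
def IsTransport {N d : ℕ} (P : Fin N → DiscreteMeasure d) (Q : DiscreteMeasure d)
    (y : Plan P Q.supp) : Prop :=
  (∀ i j, ∑ k, y i j k = Q.mass j) ∧ (∀ i k, ∑ j, y i j k = (P i).mass k) ∧
    ∀ i j k, 0 ≤ y i j k

/-- `y` is a transport from `Q` to the measures `P_1, …, P_N` of minimal cost. -/
def IsOptimalTransport {N d : ℕ} (P : Fin N → DiscreteMeasure d) (lam : Fin N → ℝ)
    (Q : DiscreteMeasure d) (y : Plan P Q.supp) : Prop :=
  IsTransport P Q y ∧ ∀ y' : Plan P Q.supp, IsTransport P Q y' → cost lam y ≤ cost lam y'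

/-- Every support point of `Q` sends its full mass to exactly one support point in each `P_i`. -/
def NonMassSplitting {N d : ℕ} {P : Fin N → DiscreteMeasure d} (Q : DiscreteMeasure d)
    (y : Plan P Q.supp) : Prop :=
  ∀ i j, ∃! k, y i j k = Q.mass j ∧ ∀ k', k' ≠ k → y i j k' = 0

/-- The variables `(z, y)` of the linear program over the possible support points `S₀`. -/
abbrev LPVar {N d : ℕ} (P : Fin N → DiscreteMeasure d) (S₀ : Finset (E d)) : Type :=
  (S₀ → ℝ) × Plan P S₀

/-- The feasible region of the linear program. -/
def lpFeasible {N d : ℕ} (P : Fin N → DiscreteMeasure d) (S₀ : Finset (E d)) :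
    Set (LPVar P S₀) :=
  {v | (∀ i j, ∑ k, v.2 i j k = v.1 j) ∧ (∀ i k, ∑ j, v.2 i j k = (P i).mass k) ∧
    ∀ i j k, 0 ≤ v.2 i j k}

/-- An optimal vertex of the linear program; this is what Algorithm 1 computes for the set `S₀`
of possible support points. -/
def IsOptimalVertex {N d : ℕ} (P : Fin N → DiscreteMeasure d) (lam : Fin N → ℝ)
    (S₀ : Finset (E d)) (v : LPVar P S₀) : Prop :=
  v ∈ (lpFeasible P S₀).extremePoints ℝ ∧ ∀ w ∈ lpFeasible P S₀, cost lam v.2 ≤ cost lam w.2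

/-! ### The data of Algorithm 2 -/

/-- An optimal solution `(z, y)` over `S₀`, together with an enumeration `s_1, …, s_r` of the
support of the measure represented by `z` (in an arbitrary order). -/
structure Stage {N d : ℕ} (P : Fin N → DiscreteMeasure d) where
  S₀ : Finset (E d)
  sol : LPVar P S₀
  r : ℕ
  s : Fin r ≃ {j : S₀ // 0 < sol.1 j}

/-- The support point `s_l`. -/
def Stage.point {N d : ℕ} {P : Fin N → DiscreteMeasure d} (st : Stage P) (l : Fin st.r) : E d :=
  ((st.s l).1 : E d)

/-- The measure represented by `z`. -/
def Stage.org {N d : ℕ} {P : Fin N → DiscreteMeasure d} (st : Stage P) : E d →₀ ℝ :=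
  ∑ j : st.S₀, Finsupp.single (j : E d) (st.sol.1 j)

/-- The current masses `d_l` of the points `s_l`, and the current partial measures `P_i^l`:
`D l i k` is the mass of the support point `k` of `P_i` in `P_i^l`, and `k` belongs to the support
of `P_i^l` if and only if this mass is positive. -/
structure Parts {N d : ℕ} (P : Fin N → DiscreteMeasure d) (r : ℕ) where
  mass : Fin r → ℝ
  D : Fin r → (i : Fin N) → (P i).supp → ℝ

/-- Step 1 of Algorithm 2: break up the measure into the parts of its support points. -/
def Stage.parts {N d : ℕ} {P : Fin N → DiscreteMeasure d} (st : Stage P) : Parts P st.r where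
  mass l := st.sol.1 (st.s l).1
  D l i k := st.sol.2 i (st.s l).1 k

/-- A choice of one support point `x_{i q_i}` in each measure `P_i`. -/
abbrev Selection {N d : ℕ} (P : Fin N → DiscreteMeasure d) : Type := (i : Fin N) → (P i).supp

/-- The weighted centroid of the selected points. -/
def centroid {N d : ℕ} {P : Fin N → DiscreteMeasure d} (lam : Fin N → ℝ) (q : Selection P) : E d :=
  ∑ i, lam i • (q i : E d)

/-- The minimal mass `d_min` among the selected points of the `P_i^l` (a minimum over the finitely
many indices `i`). -/
def Parts.minMass {N d r : ℕ} {P : Fin N → DiscreteMeasure d} (A : Parts P r) (l : Fin r)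
    (q : Selection P) : ℝ :=
  ⨅ i, A.D l i (q i)

open Classical in
/-- Add the (possibly negative) mass `m` to `d_l` and to the selected point in each `P_i^l`. -/
def Parts.addMass {N d r : ℕ} {P : Fin N → DiscreteMeasure d} (A : Parts P r) (l : Fin r)
    (q : Selection P) (m : ℝ) : Parts P r where
  mass l' := if l' = l then A.mass l' + m else A.mass l'
  D l' i k := if l' = l ∧ k = q i then A.D l' i k + m else A.D l' i k

/-- `q_i ∈ argmax (s_j - s_l)ᵀ x` over the support points `x` of `P_i^l`, for each `i`. -/
def IsArgmax {N d : ℕ} {P : Fin N → DiscreteMeasure d} (st : Stage P) (A : Parts P st.r)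
    (l j : Fin st.r) (q : Selection P) : Prop :=
  ∀ i, 0 < A.D l i (q i) ∧ ∀ k, 0 < A.D l i k →
    inner ℝ (st.point j - st.point l) (k : E d) ≤ inner ℝ (st.point j - st.point l) (q i : E d)

/-- `q_i` is the lexicographically maximal support point of `P_i^l`, for each `i`. -/
def IsLexMax {N d r : ℕ} {P : Fin N → DiscreteMeasure d} (A : Parts P r)
    (l : Fin r) (q : Selection P) : Prop :=
  ∀ i, 0 < A.D l i (q i) ∧ ∀ k, 0 < A.D l i k →
    toLex (WithLp.ofLp (k : E d)) ≤ toLex (WithLp.ofLp (q i : E d))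

/-- The pairs `(l, j)` in the order in which the double loop of Step 2 of Algorithm 2 visits them:
`l` descending, and for each `l`, the indices `j < l` ascending. -/
def loopPairs (r : ℕ) : List (Fin r × Fin r) :=
  (List.finRange r).reverse.flatMap fun l =>
    ((List.finRange r).filter fun j => j < l).map fun j => (l, j)

/-! ### Algorithm 3 as a transition system -/

/-- The configurations of Algorithm 3.
* `solve S₀`: about to run Algorithm 1 on the possible support points `S₀`;
* `shift st todo A`: in Step 2 of Algorithm 2, with the pairs in `todo` left to treat;
* `spread st todo A B`: in Step 3 of Algorithm 2, with the indices in `todo` left to treat, where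
  `B l` is the partial measure constructed for `s_l` so far;
* `compare st P'`: Algorithm 2 has returned `P'`;
* `output S₀ P'`: Algorithm 3 has returned `P'`, where `S₀` is the set of possible support points
  used in the last iteration. -/
inductive Config {N d : ℕ} (P : Fin N → DiscreteMeasure d) : Type
  | solve (S₀ : Finset (E d))
  | shift (st : Stage P) (todo : List (Fin st.r × Fin st.r)) (A : Parts P st.r)
  | spread (st : Stage P) (todo : List (Fin st.r)) (A : Parts P st.r)
      (B : Fin st.r → E d →₀ ℝ)
  | compare (st : Stage P) (P' : E d →₀ ℝ)
  | output (S₀ : Finset (E d)) (P' : E d →₀ ℝ)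

/-- One step of Algorithm 3. Everything that the pseudocode leaves open (the optimal vertex, the
enumeration of the support points, ties in the argmax) may be chosen arbitrarily. -/
inductive Step {N d : ℕ} (P : Fin N → DiscreteMeasure d) (lam : Fin N → ℝ) :
    Config P → Config P → Prop
  /-- Run Algorithm 1 and Step 1 of Algorithm 2. -/
  | solve (S₀ : Finset (E d)) (st : Stage P) (hS : st.S₀ = S₀)
      (h : IsOptimalVertex P lam st.S₀ st.sol) :
      Step P lam (.solve S₀) (.shift st (loopPairs st.r) st.parts)
  /-- Step 2: no mass is left at `s_l`, go on to the next pair. -/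
  | shiftEmpty (st : Stage P) (l j : Fin st.r) (todo : List (Fin st.r × Fin st.r))
      (A : Parts P st.r) (h : ¬ 0 < A.mass l) :
      Step P lam (.shift st ((l, j) :: todo) A) (.shift st todo A)
  /-- Step 2: the centroid is not equally far from `s_j` and `s_l`, go on to the next pair. -/
  | shiftNext (st : Stage P) (l j : Fin st.r) (todo : List (Fin st.r × Fin st.r))
      (A : Parts P st.r) (q : Selection P) (h : 0 < A.mass l) (hq : IsArgmax st A l j q)
      (hc : ‖centroid lam q - st.point j‖ ^ 2 ≠ ‖centroid lam q - st.point l‖ ^ 2) :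
      Step P lam (.shift st ((l, j) :: todo) A) (.shift st todo A)
  /-- Step 2: the centroid is equally far from `s_j` and `s_l`, move mass from `l` to `j`. -/
  | shiftMove (st : Stage P) (l j : Fin st.r) (todo : List (Fin st.r × Fin st.r))
      (A : Parts P st.r) (q : Selection P) (h : 0 < A.mass l) (hq : IsArgmax st A l j q)
      (hc : ‖centroid lam q - st.point j‖ ^ 2 = ‖centroid lam q - st.point l‖ ^ 2) :
      Step P lam (.shift st ((l, j) :: todo) A)
        (.shift st ((l, j) :: todo)
          ((A.addMass l q (-A.minMass l q)).addMass j q (A.minMass l q)))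
  /-- Step 2 is finished; start Step 3 with empty partial measures. -/
  | shiftEnd (st : Stage P) (A : Parts P st.r) :
      Step P lam (.shift st [] A) (.spread st (List.finRange st.r) A fun _ => 0)
  /-- Step 3: no mass is left at `s_l`, go on to the next index. -/
  | spreadEmpty (st : Stage P) (l : Fin st.r) (todo : List (Fin st.r)) (A : Parts P st.r)
      (B : Fin st.r → E d →₀ ℝ) (h : ¬ 0 < A.mass l) :
      Step P lam (.spread st (l :: todo) A B) (.spread st todo A B)
  /-- Step 3: move mass from `s_l` to the centroid of the lexicographically maximal points. -/
  | spreadMove (st : Stage P) (l : Fin st.r) (todo : List (Fin st.r)) (A : Parts P st.r)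
      (B : Fin st.r → E d →₀ ℝ) (q : Selection P) (h : 0 < A.mass l) (hq : IsLexMax A l q) :
      Step P lam (.spread st (l :: todo) A B)
        (.spread st (l :: todo) (A.addMass l q (-A.minMass l q))
          (Function.update B l (B l + Finsupp.single (centroid lam q) (A.minMass l q))))
  /-- Step 4: combine the partial measures. -/
  | spreadEnd (st : Stage P) (A : Parts P st.r) (B : Fin st.r → E d →₀ ℝ) :
      Step P lam (.spread st [] A B) (.compare st (∑ l, B l))
  /-- The measure has changed: iterate with its support. -/
  | again (st : Stage P) (P' : E d →₀ ℝ) (h : P' ≠ st.org) :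
      Step P lam (.compare st P') (.solve P'.support)
  /-- The measure has not changed: return it. -/
  | finish (st : Stage P) (P' : E d →₀ ℝ) (h : P' = st.org) :
      Step P lam (.compare st P') (.output st.S₀ P')

/-- `C` can be reached in a run of Algorithm 3 on the given input. -/
def Reachable {N d : ℕ} (P : Fin N → DiscreteMeasure d) (lam : Fin N → ℝ) (C : Config P) : Prop :=
  Relation.ReflTransGen (Step P lam) (.solve (unionSupp P)) C

/-- Algorithm 3 terminates, whatever choices are made: there is no infinite run, and a run that
has not returned a measure yet can be continued. -/
def Terminates {N d : ℕ} (P : Fin N → DiscreteMeasure d) (lam : Fin N → ℝ) : Prop :=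
  (¬ ∃ C : ℕ → Config P, C 0 = .solve (unionSupp P) ∧ ∀ n, Step P lam (C n) (C (n + 1))) ∧
    ∀ C, Reachable P lam C → (∃ S₀ P', C = .output S₀ P') ∨ ∃ C', Step P lam C C'

end DiscreteBarycenter

end

/-!
The three phases of an iteration (solving the linear program, shifting mass between the points
`s_l`, spreading mass to weighted centroids) all work with the same kind of object: finitely many
point masses, each transported in full to every `P_i`, and together exhausting every `P_i`
(`IsFamily`). Such a family can be merged into a feasible solution over any set that contains its
points (`IsFamily.exists_feasible`), so its cost is at least the optimal value over that set.

*Cost accounting.* By the variance identity `sum_mul_norm_sub_sq`, transporting unit mass from `s`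
to a selection `q` costs `‖c(q) - s‖²` plus a term that does not depend on `s`, where `c(q)` is the
weighted centroid. Hence a move of the shift phase, between two points that are equally far from
`c(q)`, keeps the solution optimal, and the spread phase saves `∑ W l q * ‖c(q) - s_l‖²`, where
`W l q` is the mass that is moved from `s_l` to `c(q)`.

*An iteration improves strictly or changes nothing* (`IsSpread.iterationResult`). If nothing is
saved, all `c(q)` in use at `s_l` equal `s_l`. As the selections used at `s_l` decrease
lexicographically, their centroids are distinct, so there is only one of them: no mass is split.
Moreover the shift phase cannot have made a move: the last selection moved, say from `s_l` to
`s_j`, is still contained in the parts of `s_j`, and its centroid, equally far from `s_l` and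
`s_j`, is not `s_j` (`HasImprovement`). So the measure is the one represented by the vertex.

*Termination.* After the first iteration, all sets of possible support points consist of weighted
centroids, and there are finitely many such sets; the number of those with a smaller optimal value
decreases from one iteration to the next (`numBetter_lt`). Within an iteration, each move exhausts
a support point of the part that it takes mass from (`Parts.numPos_removeMin_lt`).

*The returned measure.* It is unchanged by its iteration, so the vertex does not split mass, and
its masses are the only solution of a linear system of rank at most `∑ |P_i| - N + 1`
(`card_le_of_nonSplitting`). Transports from a discrete measure correspond to families of couplings
(`le_phi_toMeasure`, `phi_toMeasure_le`), so optimality in the linear program is optimality for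
`φ`. For the factor `2`, the optimal values do not increase, so the first one has to be bounded:
given couplings of any `μ` with the `P_i`, the mixture `∑ λ_i P_i` is transported to each `P_j` by
drawing from the conditional distributions given a common point of `μ`, independently
(`exists_feasible_unionSupp`). The mean squared distance of two independent copies is at most twice
the mean squared distance from that point.
-/

namespace DiscreteBarycenter

variable {N d : ℕ} {P : Fin N → DiscreteMeasure d} {lam : Fin N → ℝ}

/-! ### Transport families -/

/-- A family of masses `m a`, indexed by an arbitrary finite type, together with transports
`D a i` of `m a` into each `P_i`; altogether the `D a i` exhaust `P_i`. This is the common form of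
the feasible solutions of the linear program, of the transports from a measure, and of the parts
maintained by the algorithm; the location of the masses plays no role. -/
structure IsFamily {ι : Type*} [Fintype ι] (P : Fin N → DiscreteMeasure d) (m : ι → ℝ)
    (D : ι → (i : Fin N) → (P i).supp → ℝ) : Prop where
  nonneg : ∀ a i k, 0 ≤ D a i k
  row : ∀ a i, ∑ k, D a i k = m a
  col : ∀ i k, ∑ a, D a i k = (P i).mass k

/-- The cost of a transport family whose masses are located at the points `p a`. -/
noncomputable def famCost {ι : Type*} [Fintype ι] (lam : Fin N → ℝ) (p : ι → E d)
    (D : ι → (i : Fin N) → (P i).supp → ℝ) : ℝ :=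
  ∑ i, lam i * ∑ a, ∑ k : (P i).supp, ‖p a - (k : E d)‖ ^ 2 * D a i k

theorem cost_eq_famCost {S₀ : Finset (E d)} (y : Plan P S₀) :
    cost lam y = famCost lam (fun j : S₀ => (j : E d)) (fun j i k => y i j k) := rfl

theorem mem_lpFeasible_iff {S₀ : Finset (E d)} {v : LPVar P S₀} :
    v ∈ lpFeasible P S₀ ↔ IsFamily P v.1 (fun j i k => v.2 i j k) :=
  ⟨fun h => ⟨fun a i k => h.2.2 i a k, fun a i => h.1 i a, h.2.1⟩,
    fun h => ⟨fun i j => h.row j i, h.col, fun i j k => h.nonneg j i k⟩⟩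

theorem isTransport_iff {Q : DiscreteMeasure d} {y : Plan P Q.supp} :
    IsTransport P Q y ↔
      IsFamily P (fun j : Q.supp => Q.mass j) (fun j i k => y i j k) :=
  ⟨fun h => ⟨fun a i k => h.2.2 i a k, fun a i => h.1 i a, h.2.1⟩,
    fun h => ⟨fun i j => h.row j i, h.col, fun i j k => h.nonneg j i k⟩⟩

theorem pos_of_sum_eq_one (hsum : ∑ i, lam i = 1) : 0 < N := by
  rcases Nat.eq_zero_or_pos N with rfl | h
  · simp at hsum
  · exact h

section Family

variable {ι : Type*} [Fintype ι] {m : ι → ℝ} {D : ι → (i : Fin N) → (P i).supp → ℝ}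

theorem IsFamily.mass_nonneg (h : IsFamily P m D) (hN : 0 < N) (a : ι) : 0 ≤ m a := by
  rw [← h.row a ⟨0, hN⟩]
  exact Finset.sum_nonneg fun k _ => h.nonneg a _ k

theorem IsFamily.eq_zero (h : IsFamily P m D) {a : ι} (ha : m a = 0) (i : Fin N)
    (k : (P i).supp) : D a i k = 0 := by
  have h1 := h.row a i
  rw [ha, Finset.sum_eq_zero_iff_of_nonneg fun k _ => h.nonneg a i k] at h1
  exact h1 k (Finset.mem_univ k)

theorem IsFamily.le_mass (h : IsFamily P m D) (a : ι) (i : Fin N) (k : (P i).supp) :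
    D a i k ≤ m a := by
  rw [← h.row a i]
  exact Finset.single_le_sum (f := fun k => D a i k) (fun k _ => h.nonneg a i k)
    (Finset.mem_univ k)

theorem IsFamily.exists_pos (h : IsFamily P m D) {a : ι} (ha : 0 < m a) (i : Fin N) :
    ∃ k, 0 < D a i k := by
  by_contra hc
  push Not at hc
  have := Finset.sum_nonpos fun k (_ : k ∈ Finset.univ) => hc k
  rw [h.row a i] at this
  linarith

theorem IsFamily.sum_mass (h : IsFamily P m D) (hN : 0 < N) : ∑ a, m a = 1 := by
  calc ∑ a, m a = ∑ a, ∑ k, D a ⟨0, hN⟩ k := by simp_rw [h.row]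
    _ = ∑ k : (P ⟨0, hN⟩).supp, (P ⟨0, hN⟩).mass k := by
      rw [Finset.sum_comm]; simp_rw [h.col]
    _ = 1 := by
      rw [Finset.sum_coe_sort (P ⟨0, hN⟩).supp fun x => (P ⟨0, hN⟩).mass x]
      exact (P ⟨0, hN⟩).total

open Classical in
/-- Masses located at the same point can be merged: a transport family with all its mass in `T`
yields a feasible solution over `T` of the same cost. -/
theorem IsFamily.exists_feasible (h : IsFamily P m D) (p : ι → E d) (T : Finset (E d))
    (hT : ∀ a, m a ≠ 0 → p a ∈ T) :
    ∃ v ∈ lpFeasible P T, (∀ j, v.1 j = ∑ a, if p a = j then m a else 0) ∧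
      cost lam v.2 = famCost lam p D := by
  have key : ∀ (a : ι) (i : Fin N) (k : (P i).supp) (g : E d → ℝ),
      ∑ j : T, g j * (if p a = j then D a i k else 0) = g (p a) * D a i k := by
    intro a i k g
    rw [Finset.sum_coe_sort T fun j => g j * (if p a = j then D a i k else 0)]
    simp only [mul_ite, mul_zero]
    rw [Finset.sum_ite_eq]
    split_ifs with hp
    · rfl
    · rw [h.eq_zero (by_contra fun h' => hp (hT a h')) i k, mul_zero]
  refine ⟨⟨fun j => ∑ a, if p a = j then m a else 0,
    fun i j k => ∑ a, if p a = j then D a i k else 0⟩, ⟨?_, ?_, ?_⟩, fun j => rfl, ?_⟩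
  · intro i j
    rw [Finset.sum_comm]
    refine Finset.sum_congr rfl fun a _ => ?_
    split_ifs
    · exact h.row a i
    · simp
  · intro i k
    rw [Finset.sum_comm, ← h.col i k]
    refine Finset.sum_congr rfl fun a _ => ?_
    simpa using key a i k fun _ => 1
  · intro i j k
    exact Finset.sum_nonneg fun a _ => by split_ifs <;> simp [h.nonneg]
  · unfold cost famCost
    refine Finset.sum_congr rfl fun i _ => congrArg _ ?_
    simp_rw [Finset.mul_sum]
    rw [Finset.sum_comm, Finset.sum_comm (s := (Finset.univ : Finset ι))]
    refine Finset.sum_congr rfl fun k _ => ?_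
    rw [Finset.sum_comm]
    exact Finset.sum_congr rfl fun a _ => key a i k fun x => ‖x - (k : E d)‖ ^ 2

end Family

/-! ### Weighted centroids -/

/-- The weighted variance identity: moving from a point `s` to the weighted centroid saves the
squared distance. -/
theorem sum_mul_norm_sub_sq {ι : Type*} [Fintype ι] {lam : ι → ℝ} (hsum : ∑ i, lam i = 1)
    (x : ι → E d) (s : E d) :
    ∑ i, lam i * ‖s - x i‖ ^ 2 =
      ‖(∑ i, lam i • x i) - s‖ ^ 2 +
        ∑ i, lam i * ‖(∑ i, lam i • x i) - x i‖ ^ 2 := by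
  set c := ∑ i, lam i • x i with hc
  have h1 : ∀ i, lam i * ‖s - x i‖ ^ 2 =
      lam i * ‖c - s‖ ^ 2 + lam i * ‖c - x i‖ ^ 2 -
        2 * inner ℝ (c - s) (lam i • c - lam i • x i) := by
    intro i
    have : s - x i = (c - x i) - (c - s) := by abel
    rw [this, @norm_sub_sq_real, ← smul_sub, real_inner_smul_right, real_inner_comm]
    ring
  have h2 : ∑ i, (lam i • c - lam i • x i) = 0 := by
    rw [Finset.sum_sub_distrib, ← Finset.sum_smul, hsum, ← hc, one_smul, sub_self]
  simp_rw [h1]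
  rw [Finset.sum_sub_distrib, Finset.sum_add_distrib, ← Finset.sum_mul, hsum, one_mul,
    ← Finset.mul_sum, ← inner_sum, h2, inner_zero_right]
  ring

theorem sum_mul_norm_sub_selection_sq (hsum : ∑ i, lam i = 1) (q : Selection P) (s : E d) :
    ∑ i, lam i * ‖s - (q i : E d)‖ ^ 2 =
      ‖centroid lam q - s‖ ^ 2 + ∑ i, lam i * ‖centroid lam q - (q i : E d)‖ ^ 2 :=
  sum_mul_norm_sub_sq hsum _ s

theorem toLex_smul_lt {a : ℝ} (ha : 0 < a) {x y : Fin d → ℝ} (h : toLex x < toLex y) :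
    toLex (a • x) < toLex (a • y) := by
  obtain ⟨i, h1, h2⟩ := h
  exact ⟨i, fun j hj => congrArg (a * ·) (h1 j hj), mul_lt_mul_of_pos_left h2 ha⟩

/-- The weighted centroid is strictly monotone in the lexicographic order. -/
theorem centroid_ne_of_lex (hpos : ∀ i, 0 < lam i) {q q' : Selection P}
    (hle : ∀ i, toLex (WithLp.ofLp (q' i : E d)) ≤ toLex (WithLp.ofLp (q i : E d)))
    (hne : q' ≠ q) : centroid lam q' ≠ centroid lam q := by
  obtain ⟨i₀, hi₀⟩ := Function.ne_iff.1 hne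
  have hsm : ∀ i, (q' i : E d) ≠ q i →
      toLex (lam i • WithLp.ofLp (q' i : E d)) < toLex (lam i • WithLp.ofLp (q i : E d)) := by
    intro i hi
    refine toLex_smul_lt (hpos i) (lt_of_le_of_ne (hle i) fun h => hi ?_)
    exact WithLp.ofLp_injective 2 (toLex.injective h)
  have hlt : ∑ i, toLex (lam i • WithLp.ofLp (q' i : E d)) <
      ∑ i, toLex (lam i • WithLp.ofLp (q i : E d)) := by
    refine Finset.sum_lt_sum (fun i _ => ?_)
      ⟨i₀, Finset.mem_univ _, hsm i₀ fun h => hi₀ (Subtype.ext h)⟩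
    by_cases hi : (q' i : E d) = q i
    · rw [hi]
    · exact (hsm i hi).le
  intro h
  have e : ∀ q : Selection P, toLex (WithLp.ofLp (centroid lam q)) =
      ∑ i, toLex (lam i • WithLp.ofLp (q i : E d)) := by
    intro q
    unfold centroid
    rw [WithLp.ofLp_sum]
    rfl
  rw [← e, ← e, h] at hlt
  exact lt_irrefl _ hlt

/-! ### Moving mass between parts -/

section AddMass

variable {r : ℕ} (A : Parts P r) (l : Fin r) (q : Selection P) (m : ℝ)

theorem Parts.addMass_mass (l' : Fin r) :
    (A.addMass l q m).mass l' = A.mass l' + if l' = l then m else 0 := by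
  simp only [Parts.addMass]
  split_ifs <;> simp

open Classical in
theorem Parts.addMass_D (l' : Fin r) (i : Fin N) (k : (P i).supp) :
    (A.addMass l q m).D l' i k = A.D l' i k + if l' = l ∧ k = q i then m else 0 := by
  simp only [Parts.addMass]
  split_ifs <;> simp

theorem Parts.sum_addMass_row (l' : Fin r) (i : Fin N) :
    ∑ k, (A.addMass l q m).D l' i k = (∑ k, A.D l' i k) + if l' = l then m else 0 := by
  classical
  simp_rw [Parts.addMass_D, Finset.sum_add_distrib, ite_and]
  split_ifs <;> simp

open Classical in
theorem Parts.sum_addMass_col (i : Fin N) (k : (P i).supp) :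
    ∑ l', (A.addMass l q m).D l' i k = (∑ l', A.D l' i k) + if k = q i then m else 0 := by
  simp_rw [Parts.addMass_D, Finset.sum_add_distrib, ite_and]
  simp

theorem famCost_addMass (p : Fin r → E d) :
    famCost lam p (A.addMass l q m).D =
      famCost lam p A.D + m * ∑ i, lam i * ‖p l - (q i : E d)‖ ^ 2 := by
  classical
  unfold famCost
  rw [Finset.mul_sum, ← Finset.sum_add_distrib]
  refine Finset.sum_congr rfl fun i _ => ?_
  simp_rw [Parts.addMass_D, mul_add, Finset.sum_add_distrib, ite_and]
  simp only [mul_ite, mul_zero, Finset.sum_ite_irrel, Finset.sum_const_zero, Finset.sum_ite_eq',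
    Finset.mem_univ, if_true]
  ring

theorem Parts.minMass_le (i : Fin N) : A.minMass l q ≤ A.D l i (q i) :=
  ciInf_le (Set.finite_range _).bddBelow i

theorem Parts.exists_eq_minMass (hN : 0 < N) : ∃ i, A.D l i (q i) = A.minMass l q := by
  have : Nonempty (Fin N) := ⟨⟨0, hN⟩⟩
  exact exists_eq_ciInf_of_finite

theorem Parts.minMass_pos (hN : 0 < N) (hq : ∀ i, 0 < A.D l i (q i)) : 0 < A.minMass l q := by
  obtain ⟨i, hi⟩ := A.exists_eq_minMass l q hN
  exact hi ▸ hq i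

variable {A l q}

theorem Parts.removeMin_nonneg (hA : ∀ l i k, 0 ≤ A.D l i k) (l' : Fin r) (i : Fin N)
    (k : (P i).supp) : 0 ≤ (A.addMass l q (-A.minMass l q)).D l' i k := by
  classical
  rw [Parts.addMass_D]
  split_ifs with h
  · obtain ⟨rfl, rfl⟩ := h
    linarith [A.minMass_le l' q i]
  · simpa using hA l' i k

theorem Parts.removeMin_le (hA : ∀ l i k, 0 ≤ A.D l i k) (hN : 0 < N) (l' : Fin r) (i : Fin N)
    (k : (P i).supp) : (A.addMass l q (-A.minMass l q)).D l' i k ≤ A.D l' i k := by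
  classical
  obtain ⟨i', hi'⟩ := A.exists_eq_minMass l q hN
  have : 0 ≤ A.minMass l q := hi' ▸ hA l i' (q i')
  rw [Parts.addMass_D]
  split_ifs <;> linarith

theorem Parts.exists_removeMin_eq_zero (hN : 0 < N) :
    ∃ i, A.D l i (q i) = A.minMass l q ∧
      (A.addMass l q (-A.minMass l q)).D l i (q i) = 0 := by
  classical
  obtain ⟨i, hi⟩ := A.exists_eq_minMass l q hN
  refine ⟨i, hi, ?_⟩
  rw [Parts.addMass_D, if_pos ⟨rfl, rfl⟩]
  linarith

end AddMass

open Classical in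
/-- The number of positive masses in the partial measures at `s_l`; it bounds the number of moves
away from `s_l`. -/
noncomputable def Parts.numPos {r : ℕ} (A : Parts P r) (l : Fin r) : ℕ :=
  (Finset.univ.filter fun x : (i : Fin N) × (P i).supp => 0 < A.D l x.1 x.2).card

theorem Parts.numPos_congr {r : ℕ} {A A' : Parts P r} {l : Fin r}
    (h : ∀ i k, A'.D l i k = A.D l i k) : A'.numPos l = A.numPos l := by
  unfold Parts.numPos
  simp_rw [h]

/-- Moving away the minimal mass exhausts a selected point. -/
theorem Parts.numPos_removeMin_lt {r : ℕ} {A : Parts P r} {l : Fin r} {q : Selection P}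
    (hA : ∀ l i k, 0 ≤ A.D l i k) (hN : 0 < N) (hq : ∀ i, 0 < A.D l i (q i)) :
    (A.addMass l q (-A.minMass l q)).numPos l < A.numPos l := by
  classical
  unfold Parts.numPos
  obtain ⟨i, -, hi⟩ := A.exists_removeMin_eq_zero (l := l) (q := q) hN
  refine Finset.card_lt_card (Finset.ssubset_iff_of_subset ?_ |>.2 ⟨⟨i, q i⟩, ?_, ?_⟩)
  · intro x hx
    simp only [Finset.mem_filter, Finset.mem_univ, true_and] at hx ⊢
    exact hx.trans_le (Parts.removeMin_le hA hN _ _ _)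
  · simpa using hq i
  · simp [hi]

/-! ### Shifting mass between support points of equal cost -/

/-- Parts that form a transport family with the cost of the solution of the linear program. -/
structure IsOptimalParts (lam : Fin N → ℝ) (st : Stage P) (A : Parts P st.r) : Prop where
  family : IsFamily P A.mass A.D
  cost_eq : famCost lam st.point A.D = cost lam st.sol.2

/-- Some `s_j` has in its parts a selection whose weighted centroid differs from `s_j`. -/
def HasImprovement (lam : Fin N → ℝ) (st : Stage P) (A : Parts P st.r) : Prop :=
  ∃ (j : Fin st.r) (q : Selection P), (∀ i, 0 < A.D j i (q i)) ∧ centroid lam q ≠ st.point j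

theorem Stage.point_injective (st : Stage P) : Function.Injective st.point := fun _ _ h =>
  st.s.injective (Subtype.ext (Subtype.ext h))

theorem Stage.sum_eq {st : Stage P} (f : st.S₀ → ℝ)
    (hf : ∀ j, ¬ 0 < st.sol.1 j → f j = 0) : ∑ l, f (st.s l).1 = ∑ j, f j := by
  refine Fintype.sum_of_injective (fun l => (st.s l).1)
    (fun a b h => st.s.injective (Subtype.ext h)) _ _ (fun j hj => hf j fun hpos => hj ?_)
    fun l => rfl
  exact ⟨st.s.symm ⟨j, hpos⟩, by simp⟩

theorem isOptimalParts_parts {st : Stage P} (hN : 0 < N) (h : st.sol ∈ lpFeasible P st.S₀) :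
    IsOptimalParts lam st st.parts := by
  have hF := mem_lpFeasible_iff.1 h
  have hz : ∀ j, ¬ 0 < st.sol.1 j → ∀ i k, st.sol.2 i j k = 0 := fun j hj =>
    hF.eq_zero (le_antisymm (not_lt.1 hj) (hF.mass_nonneg hN j))
  refine ⟨⟨fun a i k => hF.nonneg _ i k, fun a i => hF.row _ i, fun i k => ?_⟩, ?_⟩
  · rw [← hF.col i k]
    exact Stage.sum_eq (fun j => st.sol.2 i j k) fun j hj => hz j hj i k
  · rw [cost_eq_famCost]
    unfold famCost
    refine Finset.sum_congr rfl fun i _ => congrArg _ ?_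
    exact Stage.sum_eq (fun j => ∑ k : (P i).supp, ‖(j : E d) - k‖ ^ 2 * st.sol.2 i j k)
      fun j hj => Finset.sum_eq_zero fun k _ => by rw [hz j hj, mul_zero]

/-- A move of the shift phase does not change the cost: the costs of the selection at the two
points differ by the difference of the squared distances to its centroid. -/
theorem IsOptimalParts.shiftMove {st : Stage P} {A : Parts P st.r} (h : IsOptimalParts lam st A)
    (hN : 0 < N) (hsum : ∑ i, lam i = 1) {l j : Fin st.r} {q : Selection P}
    (hq : ∀ i, 0 < A.D l i (q i))
    (hc : ‖centroid lam q - st.point j‖ ^ 2 = ‖centroid lam q - st.point l‖ ^ 2) :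
    IsOptimalParts lam st
      ((A.addMass l q (-A.minMass l q)).addMass j q (A.minMass l q)) := by
  classical
  refine ⟨⟨fun a i k => ?_, fun a i => ?_, fun i k => ?_⟩, ?_⟩
  · have h1 := Parts.removeMin_nonneg (l := l) (q := q) h.family.nonneg a i k
    have h2 := A.minMass_pos l q hN hq
    rw [Parts.addMass_D]
    split_ifs <;> linarith
  · rw [Parts.sum_addMass_row, Parts.sum_addMass_row, Parts.addMass_mass, Parts.addMass_mass,
      h.family.row]
  · rw [Parts.sum_addMass_col, Parts.sum_addMass_col, h.family.col]
    split_ifs <;> ring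
  · rw [famCost_addMass, famCost_addMass, h.cost_eq,
      sum_mul_norm_sub_selection_sq hsum q (st.point l),
      sum_mul_norm_sub_selection_sq hsum q (st.point j), hc]
    ring

/-- After a move of the shift phase to `s_j`, the moved selection lies in the parts of `s_j`, but its
centroid, being equally far from two different points, is not `s_j`. -/
theorem hasImprovement_shiftMove {st : Stage P} {A : Parts P st.r}
    (hA : IsOptimalParts lam st A) (hN : 0 < N) {l j : Fin st.r} (hjl : j ≠ l) {q : Selection P}
    (hq : ∀ i, 0 < A.D l i (q i))
    (hc : ‖centroid lam q - st.point j‖ ^ 2 = ‖centroid lam q - st.point l‖ ^ 2) :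
    HasImprovement lam st
      ((A.addMass l q (-A.minMass l q)).addMass j q (A.minMass l q)) := by
  classical
  refine ⟨j, q, fun i => ?_, fun h => hjl (st.point_injective ?_)⟩
  · have h1 := Parts.removeMin_nonneg (l := l) (q := q) hA.family.nonneg j i (q i)
    have h2 := A.minMass_pos l q hN hq
    rw [Parts.addMass_D, if_pos ⟨rfl, rfl⟩]
    linarith
  · rw [h, sub_self, norm_zero, zero_pow two_ne_zero, eq_comm, sq_eq_zero_iff, norm_eq_zero,
      sub_eq_zero] at hc
    exact hc

/-! ### Spreading the parts to weighted centroids -/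

open Classical in
/-- The state of the spread phase that was started with the parts `A₀`: `W l q` is the mass that has
been moved from `s_l` to the centroid of the selection `q`. The field `lex` says that every such
selection dominates what is left at `s_l` lexicographically and has an exhausted point. -/
structure IsSpread {r : ℕ} (lam : Fin N → ℝ) (A₀ A : Parts P r) (B : Fin r → E d →₀ ℝ)
    (W : Fin r → Selection P → ℝ) : Prop where
  nonneg : ∀ l i k, 0 ≤ A.D l i k
  row : ∀ l i, ∑ k, A.D l i k = A.mass l
  W_nonneg : ∀ l q, 0 ≤ W l q
  B_eq : ∀ l, B l = ∑ q, Finsupp.single (centroid lam q) (W l q)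
  D_eq : ∀ l i k, A₀.D l i k = A.D l i k + ∑ q, if q i = k then W l q else 0
  mass_eq : ∀ l, A₀.mass l = A.mass l + ∑ q, W l q
  lex : ∀ l q, 0 < W l q →
    (∀ i k, 0 < A.D l i k →
      toLex (WithLp.ofLp (k : E d)) ≤ toLex (WithLp.ofLp (q i : E d))) ∧
    ∃ i, A.D l i (q i) = 0
  inj : ∀ l q q', 0 < W l q → 0 < W l q' → centroid lam q = centroid lam q' → q = q'

theorem isSpread_start {r : ℕ} {A : Parts P r} (h : IsFamily P A.mass A.D) :
    IsSpread lam A A (fun _ => 0) fun _ _ => 0 := by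
  refine ⟨h.nonneg, h.row, ?_, ?_, ?_, ?_, ?_, ?_⟩ <;> simp

open Classical in
theorem IsSpread.spreadMove {r : ℕ} {A₀ A : Parts P r} {B : Fin r → E d →₀ ℝ}
    {W : Fin r → Selection P → ℝ} (h : IsSpread lam A₀ A B W) (hN : 0 < N)
    (hpos : ∀ i, 0 < lam i) {l : Fin r} {q : Selection P} (hq : IsLexMax A l q) :
    IsSpread lam A₀ (A.addMass l q (-A.minMass l q))
      (Function.update B l (B l + Finsupp.single (centroid lam q) (A.minMass l q)))
      (fun l' q' => W l' q' + if l' = l ∧ q' = q then A.minMass l q else 0) := by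
  have hm := A.minMass_pos l q hN fun i => (hq i).1
  have hle := Parts.removeMin_le (l := l) (q := q) h.nonneg hN
  have hnn := Parts.removeMin_nonneg (l := l) (q := q) h.nonneg
  have hcases : ∀ {l' q'}, 0 < W l' q' + (if l' = l ∧ q' = q then A.minMass l q else 0) →
      (l' = l ∧ q' = q) ∨ 0 < W l' q' := by
    intro l' q' h'
    by_cases hc : l' = l ∧ q' = q
    · exact Or.inl hc
    · rw [if_neg hc, add_zero] at h'
      exact Or.inr h'
  -- a selection used before at `s_l` has a centroid different from that of `q`
  have hsep : ∀ q', 0 < W l q' → centroid lam q ≠ centroid lam q' := by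
    intro q' hq'
    obtain ⟨h1, i, h2⟩ := h.lex l q' hq'
    refine centroid_ne_of_lex hpos (fun i => h1 i _ (hq i).1) ?_
    rintro rfl
    exact (hq i).1.ne' h2
  refine ⟨hnn, fun l' i => ?_, fun l' q' => ?_, fun l' => ?_, fun l' i k => ?_, fun l' => ?_,
    fun l' q' h' => ?_, fun l' q' q'' h' h'' hc => ?_⟩
  · rw [Parts.sum_addMass_row, Parts.addMass_mass, h.row]
  · have := h.W_nonneg l' q'
    split_ifs <;> linarith
  · by_cases hl : l' = l
    · subst hl
      simp only [Function.update_self, true_and, Finsupp.single_add, Finset.sum_add_distrib,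
        h.B_eq]
      congr 1
      rw [Finset.sum_eq_single q] <;> simp +contextual
    · simp only [Function.update_of_ne hl, hl, false_and, if_false, add_zero, h.B_eq]
  · rw [Parts.addMass_D, h.D_eq]
    have : ∀ q', (if q' i = k then W l' q' + (if l' = l ∧ q' = q then A.minMass l q else 0)
        else 0) = (if q' i = k then W l' q' else 0) +
          if q' = q then (if l' = l ∧ k = q i then A.minMass l q else 0) else 0 := by
      intro q'
      by_cases h1 : q' = q
      · subst h1
        by_cases h2 : q' i = k
        · subst h2; simp
        · simp [h2, Ne.symm h2]
      · simp [h1]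
    simp_rw [this, Finset.sum_add_distrib]
    rw [Finset.sum_ite_eq' Finset.univ q]
    simp only [Finset.mem_univ, if_true]
    split_ifs <;> ring
  · rw [Parts.addMass_mass, h.mass_eq, Finset.sum_add_distrib]
    by_cases hl : l' = l
    · simp [hl]; ring
    · simp [hl]
  · rcases hcases h' with ⟨rfl, rfl⟩ | hW
    · obtain ⟨i, -, hi⟩ := A.exists_removeMin_eq_zero (l := l') (q := q') hN
      exact ⟨fun i k hk => (hq i).2 k (hk.trans_le (hle l' i k)), i, hi⟩
    · obtain ⟨h1, i, h2⟩ := h.lex l' q' hW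
      exact ⟨fun i k hk => h1 i k (hk.trans_le (hle l' i k)), i,
        le_antisymm (h2 ▸ hle l' i (q' i)) (hnn l' i (q' i))⟩
  · rcases hcases h' with ⟨rfl, rfl⟩ | hW <;> rcases hcases h'' with ⟨hl, rfl⟩ | hW'
    · rfl
    · exact absurd hc (hsep _ hW')
    · subst hl
      exact absurd hc.symm (hsep _ hW)
    · exact h.inj l' q' q'' hW hW' hc

/-! ### The effect of one iteration -/

theorem Stage.org_eq {st : Stage P} (hN : 0 < N) (h : st.sol ∈ lpFeasible P st.S₀) :
    st.org = ∑ l, Finsupp.single (st.point l) (st.sol.1 (st.s l).1) := by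
  have hF := mem_lpFeasible_iff.1 h
  symm
  refine Fintype.sum_of_injective (fun l => (st.s l).1)
    (fun a b h => st.s.injective (Subtype.ext h)) _ _ (fun j hj => ?_) fun l => rfl
  have : st.sol.1 j = 0 := by
    refine le_antisymm (not_lt.1 fun hpos => hj ⟨st.s.symm ⟨j, hpos⟩, by simp⟩)
      (hF.mass_nonneg hN j)
  rw [this, Finsupp.single_zero]

theorem Stage.org_apply (st : Stage P) (j : st.S₀) : st.org j = st.sol.1 j := by
  unfold Stage.org
  rw [Finsupp.finsetSum_apply, Finset.sum_eq_single j]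
  · simp
  · intro b _ hb
    exact Finsupp.single_eq_of_ne fun h => hb (Subtype.ext h.symm)
  · simp

theorem Stage.org_support_subset (st : Stage P) : st.org.support ⊆ st.S₀ := by
  intro x hx
  by_contra hxS
  refine Finsupp.mem_support_iff.1 hx ?_
  unfold Stage.org
  rw [Finsupp.finsetSum_apply]
  refine Finset.sum_eq_zero fun j _ => Finsupp.single_eq_of_ne ?_
  rintro rfl
  exact hxS j.2

/-- What is known when one iteration has turned the solution of the stage `st` into `P'`: unless
`P'` is the measure represented by this solution, it has a strictly better transport; and if it
is, then the solution does not split mass and all its support points are centroids. -/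
structure IterationResult (lam : Fin N → ℝ) (st : Stage P) (P' : E d →₀ ℝ) : Prop where
  support : ∀ x ∈ P'.support, ∃ q : Selection P, centroid lam q = x
  improve : ∃ v ∈ lpFeasible P P'.support, cost lam v.2 ≤ cost lam st.sol.2 ∧
    (P' ≠ st.org → cost lam v.2 < cost lam st.sol.2)
  nonSplitting : P' = st.org → ∀ l, ∃ q : Selection P, centroid lam q = st.point l ∧
    ∀ i k, k ≠ q i → st.sol.2 i (st.s l).1 k = 0

open Classical in
/-- Spreading a part over centroids saves the squared distances between `s_l` and the
centroids. If nothing is saved, every part is concentrated on one selection with centroid `s_l`;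
in particular no mass has been moved in the shift phase. -/
theorem IsSpread.iterationResult {st : Stage P} (hN : 0 < N) (hsum : ∑ i, lam i = 1)
    (hopt : IsOptimalVertex P lam st.S₀ st.sol) {A₀ A : Parts P st.r}
    {B : Fin st.r → E d →₀ ℝ} {W : Fin st.r → Selection P → ℝ}
    (hA₀ : IsOptimalParts lam st A₀) (himp : A₀ = st.parts ∨ HasImprovement lam st A₀)
    (h : IsSpread lam A₀ A B W) (hA : ∀ l, A.mass l = 0) :
    IterationResult lam st (∑ l, B l) := by
  have hD0 : ∀ l i k, A.D l i k = 0 := by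
    intro l i k
    have h1 := h.row l i
    rw [hA, Finset.sum_eq_zero_iff_of_nonneg fun k _ => h.nonneg l i k] at h1
    exact h1 k (Finset.mem_univ k)
  have hD : ∀ l i k, A₀.D l i k = ∑ q, if q i = k then W l q else 0 := by
    intro l i k
    rw [h.D_eq, hD0, zero_add]
  have hmass : ∀ l, A₀.mass l = ∑ q, W l q := by
    intro l
    rw [h.mass_eq, hA, zero_add]
  set p : Fin st.r × Selection P → E d := fun a => centroid lam a.2
  set m : Fin st.r × Selection P → ℝ := fun a => W a.1 a.2
  set D : Fin st.r × Selection P → (i : Fin N) → (P i).supp → ℝ :=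
    fun a i k => if a.2 i = k then W a.1 a.2 else 0 with hDdef
  have hfam : IsFamily P m D := by
    refine ⟨fun a i k => ?_, fun a i => ?_, fun i k => ?_⟩
    · have := h.W_nonneg a.1 a.2
      simp only [hDdef]
      split_ifs <;> simp [this]
    · simp [hDdef, m]
    · rw [← hA₀.family.col i k, Fintype.sum_prod_type]
      simp_rw [hD]
      rfl
  have hP' : ∑ l, B l = ∑ a, Finsupp.single (p a) (m a) := by
    rw [Fintype.sum_prod_type]
    simp_rw [h.B_eq]
    rfl
  have happly : ∀ x, (∑ l, B l) x = ∑ a, if p a = x then m a else 0 := by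
    intro x
    rw [hP', Finsupp.finsetSum_apply]
    exact Finset.sum_congr rfl fun a _ => by rw [Finsupp.single_apply]
  have hm0 : ∀ a, 0 ≤ m a := fun a => h.W_nonneg _ _
  have hsupp : ∀ a, m a ≠ 0 → p a ∈ (∑ l, B l).support := by
    intro a ha
    rw [Finsupp.mem_support_iff, happly]
    have h1 := Finset.single_le_sum (f := fun b => if p b = p a then m b else 0)
      (fun b _ => by split_ifs <;> simp [hm0]) (Finset.mem_univ a)
    simp only [if_true] at h1
    exact ((lt_of_le_of_ne (hm0 a) ha.symm).trans_le h1).ne'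
  have hcost : famCost lam p D =
      cost lam st.sol.2 - ∑ a, m a * ‖p a - st.point a.1‖ ^ 2 := by
    have e : ∀ p' : Fin st.r × Selection P → E d, famCost lam p' D =
        ∑ a, m a * ∑ i, lam i * ‖p' a - (a.2 i : E d)‖ ^ 2 := by
      intro p'
      unfold famCost
      simp_rw [Finset.mul_sum]
      rw [Finset.sum_comm]
      refine Finset.sum_congr rfl fun a _ => Finset.sum_congr rfl fun i _ => ?_
      rw [Finset.sum_eq_single (a.2 i)]
      · simp only [hDdef, m, if_true]; ring
      · intro k _ hk
        simp [hDdef, hk.symm]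
      · simp
    have e2 : famCost lam (fun a : Fin st.r × Selection P => st.point a.1) D =
        cost lam st.sol.2 := by
      rw [← hA₀.cost_eq]
      unfold famCost
      refine Finset.sum_congr rfl fun i _ => congrArg _ ?_
      rw [Fintype.sum_prod_type]
      refine Finset.sum_congr rfl fun l _ => ?_
      rw [Finset.sum_comm]
      refine Finset.sum_congr rfl fun k _ => ?_
      rw [hD, Finset.mul_sum]
    rw [← e2, e, e, ← Finset.sum_sub_distrib]
    refine Finset.sum_congr rfl fun a _ => ?_
    rw [sum_mul_norm_sub_selection_sq hsum a.2 (st.point a.1)]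
    simp only [p]
    ring
  have hsave0 : ∀ a, 0 ≤ m a * ‖p a - st.point a.1‖ ^ 2 := fun a =>
    mul_nonneg (hm0 a) (sq_nonneg _)
  -- if nothing is saved, every part is concentrated on one selection
  have hfix : (∑ a, m a * ‖p a - st.point a.1‖ ^ 2 = 0) →
      A₀ = st.parts ∧ ∀ l, ∃ q : Selection P, centroid lam q = st.point l ∧
        ∀ q', q' ≠ q → W l q' = 0 := by
    intro hz
    rw [Finset.sum_eq_zero_iff_of_nonneg fun a _ => hsave0 a] at hz
    have hc : ∀ l q, 0 < W l q → centroid lam q = st.point l := by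
      intro l q hW
      have := hz (l, q) (Finset.mem_univ _)
      rcases mul_eq_zero.1 this with h1 | h1
      · exact absurd h1 hW.ne'
      · rwa [sq_eq_zero_iff, norm_eq_zero, sub_eq_zero] at h1
    have huniq : ∀ l q q', 0 < W l q → 0 < W l q' → q = q' := fun l q q' h1 h2 =>
      h.inj l q q' h1 h2 ((hc l q h1).trans (hc l q' h2).symm)
    have hex : ∀ l i k, 0 < A₀.D l i k → ∃ q, 0 < W l q ∧ q i = k := by
      intro l i k hk
      by_contra! hcon
      refine hk.ne' ((hD l i k).trans (Finset.sum_eq_zero fun q _ => ?_))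
      split_ifs with hqk
      · exact le_antisymm (not_lt.1 fun hW => hcon q hW hqk) (h.W_nonneg l q)
      · rfl
    have hparts : A₀ = st.parts := by
      refine himp.resolve_right ?_
      rintro ⟨j, q, hq, hne⟩
      choose Q hQ hQi using fun i => hex j i (q i) (hq i)
      have : Q ⟨0, hN⟩ = q := by
        funext i
        rw [huniq j _ (Q i) (hQ _) (hQ i), hQi]
      exact hne (this ▸ hc j _ (hQ ⟨0, hN⟩))
    refine ⟨hparts, fun l => ?_⟩
    have hpos : 0 < A₀.mass l := by
      rw [hparts]
      exact (st.s l).2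
    obtain ⟨k, hk⟩ := hA₀.family.exists_pos hpos ⟨0, hN⟩
    obtain ⟨q, hq, -⟩ := hex l _ k hk
    exact ⟨q, hc l q hq, fun q' hq' => le_antisymm
      (not_lt.1 fun hW => hq' (huniq l q' q hW hq)) (h.W_nonneg l q')⟩
  obtain ⟨v, hv, -, hvc⟩ := hfam.exists_feasible (lam := lam) p (∑ l, B l).support hsupp
  have hle := Finset.sum_nonneg fun a (_ : a ∈ Finset.univ) => hsave0 a
  refine ⟨fun x hx => ?_, ⟨v, hv, by linarith, fun hne => ?_⟩, fun heq l => ?_⟩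
  · by_contra! hcon
    refine Finsupp.mem_support_iff.1 hx ((happly x).trans (Finset.sum_eq_zero fun a _ => ?_))
    rw [if_neg (hcon a.2)]
  · by_contra hlt
    obtain ⟨hparts, hq⟩ := hfix (by linarith)
    refine hne ?_
    rw [Stage.org_eq hN hopt.1.1]
    refine Finset.sum_congr rfl fun l _ => ?_
    obtain ⟨q, hqc, hq0⟩ := hq l
    have h1 : st.sol.1 (st.s l).1 = W l q := by
      have : A₀.mass l = st.sol.1 (st.s l).1 := by rw [hparts]; rfl
      rw [← this, hmass, Finset.sum_eq_single q (fun q' _ hq' => hq0 q' hq') (by simp)]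
    rw [h.B_eq, Finset.sum_eq_single q, hqc, h1]
    · intro q' _ hq'
      rw [hq0 q' hq', Finsupp.single_zero]
    · simp
  · obtain ⟨w, hw, -, hwc⟩ := hfam.exists_feasible (lam := lam) p st.S₀ fun a ha =>
      st.org_support_subset (heq ▸ hsupp a ha)
    have := hopt.2 w hw
    obtain ⟨hparts, hq⟩ := hfix (by linarith)
    obtain ⟨q, hqc, hq0⟩ := hq l
    refine ⟨q, hqc, fun i k hk => ?_⟩
    have h1 : A₀.D l i k = st.sol.2 i (st.s l).1 k := by rw [hparts]; rfl
    rw [← h1, hD]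
    refine Finset.sum_eq_zero fun q' _ => ?_
    split_ifs with hk'
    · exact hq0 q' fun h' => hk (by rw [← hk', h'])
    · rfl

/-! ### Vertices of the linear program -/

theorem isCompact_lpFeasible (hN : 0 < N) (S₀ : Finset (E d)) :
    IsCompact (lpFeasible P S₀) := by
  refine IsCompact.of_isClosed_subset (isCompact_Icc (a := (0 : LPVar P S₀)) (b := 1)) ?_ ?_
  · simp only [lpFeasible, Set.ofPred_and, Set.ofPred_forall]
    refine IsClosed.inter ?_ (IsClosed.inter ?_ ?_)
    · exact isClosed_iInter fun i => isClosed_iInter fun j =>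
        isClosed_eq (by fun_prop) (by fun_prop)
    · exact isClosed_iInter fun i => isClosed_iInter fun k =>
        isClosed_eq (by fun_prop) (by fun_prop)
    · exact isClosed_iInter fun i => isClosed_iInter fun j => isClosed_iInter fun k =>
        isClosed_le (by fun_prop) (by fun_prop)
  · intro v hv
    have hF := mem_lpFeasible_iff.1 hv
    have h1 : ∀ j, v.1 j ≤ 1 := fun j => by
      rw [← hF.sum_mass hN]
      exact Finset.single_le_sum (f := v.1) (fun j _ => hF.mass_nonneg hN j) (Finset.mem_univ j)
    exact ⟨⟨fun j => hF.mass_nonneg hN j, fun i j k => hF.nonneg j i k⟩,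
      ⟨fun j => h1 j, fun i j k => (hF.le_mass j i k).trans (h1 j)⟩⟩

theorem cost_add_smul {S₀ : Finset (E d)} (a b : ℝ) (y y' : Plan P S₀) :
    cost lam (a • y + b • y') = a * cost lam y + b * cost lam y' := by
  unfold cost
  simp only [Finset.mul_sum, ← Finset.sum_add_distrib]
  refine Finset.sum_congr rfl fun i _ => Finset.sum_congr rfl fun j _ =>
    Finset.sum_congr rfl fun k _ => ?_
  simp only [Pi.add_apply, Pi.smul_apply, smul_eq_mul]
  ring

/-- A feasible linear program has an optimal vertex: an extreme point of the face of minimizers. -/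
theorem exists_isOptimalVertex (hN : 0 < N) {S₀ : Finset (E d)}
    (hne : (lpFeasible P S₀).Nonempty) : ∃ v, IsOptimalVertex P lam S₀ v := by
  have hK := isCompact_lpFeasible (P := P) hN S₀
  have hcont : Continuous fun v : LPVar P S₀ => cost lam v.2 := by
    unfold cost
    fun_prop
  set M : Set (LPVar P S₀) :=
    {v | v ∈ lpFeasible P S₀ ∧ ∀ w ∈ lpFeasible P S₀, cost lam v.2 ≤ cost lam w.2}
  obtain ⟨v₀, hv₀, hmin⟩ := hK.exists_isMinOn hne hcont.continuousOn
  have hMne : M.Nonempty := ⟨v₀, hv₀, fun w hw => hmin hw⟩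
  have hMc : IsCompact M := by
    refine hK.of_isClosed_subset ?_ fun v hv => hv.1
    have : M = lpFeasible P S₀ ∩ {v | cost lam v.2 ≤ cost lam v₀.2} := by
      ext v
      exact ⟨fun h => ⟨h.1, h.2 _ hv₀⟩, fun h => ⟨h.1, fun w hw => le_trans h.2 (hmin hw)⟩⟩
    rw [this]
    exact hK.isClosed.inter (isClosed_le hcont continuous_const)
  have hext : IsExtreme ℝ (lpFeasible P S₀) M := by
    refine ⟨fun v hv => hv.1, fun x hx y hy v hv hseg => ?_⟩
    obtain ⟨a, b, ha, hb, hab, rfl⟩ := hseg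
    refine ⟨hx, fun w hw => ?_⟩
    have h1 := hv.2 y hy
    have h2 := hv.2 w hw
    have h3 : cost lam (a • x + b • y).2 = a * cost lam x.2 + b * cost lam y.2 :=
      cost_add_smul a b x.2 y.2
    rw [h3] at h1 h2
    have ha' : b = 1 - a := by linarith
    subst ha'
    have h4 : cost lam x.2 ≤ cost lam y.2 := by
      by_contra! hlt
      nlinarith
    nlinarith
  obtain ⟨v, hv⟩ := hMc.extremePoints_nonempty hMne
  exact ⟨v, hext.extremePoints_subset_extremePoints hv, hv.1.2⟩

open Classical in
/-- If every point `s_l` of a feasible solution sends its mass to a single selection `q l`, then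
a vector `w` that perturbs the masses without violating the constraints must vanish when the
solution is a vertex. -/
theorem eq_zero_of_extreme {st : Stage P}
    (hext : st.sol ∈ (lpFeasible P st.S₀).extremePoints ℝ) {q : Fin st.r → Selection P}
    (hq : ∀ l i k, k ≠ q l i → st.sol.2 i (st.s l).1 k = 0) {w : Fin st.r → ℝ}
    (hw : ∀ i k, ∑ l, (if q l i = k then w l else 0) = 0) : w = 0 := by
  have hF := mem_lpFeasible_iff.1 hext.1
  have hval : ∀ l i, st.sol.2 i (st.s l).1 (q l i) = st.sol.1 (st.s l).1 := by
    intro l i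
    rw [← hF.row _ i, Finset.sum_eq_single (q l i) (fun k _ hk => hq l i k hk) (by simp)]
  set u : LPVar P st.S₀ :=
    ⟨fun j => ∑ l, if (st.s l).1 = j then w l else 0,
      fun i j k => ∑ l, if (st.s l).1 = j then (if q l i = k then w l else 0) else 0⟩ with hu
  have hinj : Function.Injective fun l => (st.s l).1 :=
    fun a b h => st.s.injective (Subtype.ext h)
  have hu1 : ∀ l, u.1 (st.s l).1 = w l := by
    intro l
    simp only [hu]
    rw [Finset.sum_eq_single l] <;> simp +contextual [hinj.eq_iff]
  have hu2 : ∀ l i k, u.2 i (st.s l).1 k = if q l i = k then w l else 0 := by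
    intro l i k
    simp only [hu]
    rw [Finset.sum_eq_single l] <;> simp +contextual [hinj.eq_iff]
  obtain ⟨ε, hε, hεw⟩ : ∃ ε > 0, ∀ l, ε * |w l| ≤ st.sol.1 (st.s l).1 := by
    have : ∀ l, ∀ᶠ ε in nhdsWithin (0 : ℝ) (Set.Ioi 0), ε * |w l| ≤ st.sol.1 (st.s l).1 := by
      intro l
      have h1 : Filter.Tendsto (fun ε : ℝ => ε * |w l|) (nhdsWithin 0 (Set.Ioi 0)) (nhds 0) := by
        refine tendsto_nhdsWithin_of_tendsto_nhds ?_
        have : Continuous fun ε : ℝ => ε * |w l| := by fun_prop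
        simpa using this.tendsto 0
      exact (h1.eventually (Iio_mem_nhds (st.s l).2)).mono fun ε h => h.le
    obtain ⟨ε, h1, h2⟩ := ((Filter.eventually_all.2 this).and self_mem_nhdsWithin).exists
    exact ⟨ε, h2, h1⟩
  have hfeas : ∀ t : ℝ, |t| = ε → st.sol + t • u ∈ lpFeasible P st.S₀ := by
    intro t ht
    refine ⟨fun i j => ?_, fun i k => ?_, fun i j k => ?_⟩
    · change ∑ k, (st.sol.2 i j k + t * u.2 i j k) = st.sol.1 j + t * u.1 j
      rw [Finset.sum_add_distrib, ← Finset.mul_sum, hF.row j i]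
      congr 2
      simp only [hu]
      rw [Finset.sum_comm]
      refine Finset.sum_congr rfl fun l _ => ?_
      split_ifs <;> simp
    · change ∑ j, (st.sol.2 i j k + t * u.2 i j k) = (P i).mass k
      rw [Finset.sum_add_distrib, ← Finset.mul_sum, hF.col i k]
      simp only [hu]
      rw [Finset.sum_comm]
      simp only [Finset.sum_ite_eq, Finset.mem_univ, if_true, hw, mul_zero, add_zero]
    · change 0 ≤ st.sol.2 i j k + t * u.2 i j k
      by_cases hj : ∃ l, (st.s l).1 = j
      · obtain ⟨l, rfl⟩ := hj
        rw [hu2]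
        split_ifs with hk
        · rw [← hk, hval]
          have h1 := hεw l
          have h2 := neg_abs_le (t * w l)
          rw [abs_mul, ht] at h2
          linarith
        · simpa using hF.nonneg _ i k
      · push Not at hj
        have : u.2 i j k = 0 := by simp [hu, hj]
        rw [this, mul_zero, add_zero]
        exact hF.nonneg j i k
  have hmid : st.sol ∈ openSegment ℝ (st.sol + ε • u) (st.sol + (-ε) • u) := by
    refine ⟨1 / 2, 1 / 2, by norm_num, by norm_num, by norm_num, ?_⟩
    module
  have hE := hext.2 (hfeas ε (abs_of_pos hε)) (hfeas (-ε) (by rw [abs_neg, abs_of_pos hε])) hmid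
  have hu0 : u = 0 := by
    have : ε • u = 0 := by simpa using hE
    exact (smul_eq_zero.1 this).resolve_left hε.ne'
  funext l
  rw [← hu1 l, hu0]
  rfl

open Classical in
/-- The constraints of the linear program on the masses of a solution that does not split mass
have rank at most `∑ |P_i| - N + 1`, as the constraints of each `P_i` have the same sum. Hence
a vertex of this kind has at most that many support points. -/
theorem card_le_of_nonSplitting {st : Stage P} (hN : 0 < N)
    (hext : st.sol ∈ (lpFeasible P st.S₀).extremePoints ℝ)
    (hq : ∀ l, ∃ q : Selection P, ∀ i k, k ≠ q i → st.sol.2 i (st.s l).1 k = 0) :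
    (st.r : ℤ) ≤ (∑ i, ((P i).supp.card : ℤ)) - N + 1 := by
  choose q hq using hq
  have hF := mem_lpFeasible_iff.1 hext.1
  set i₀ : Fin N := ⟨0, hN⟩
  by_contra! hlt
  have hne : ∀ i, Nonempty (P i).supp := by
    intro i
    by_contra hE
    rw [not_nonempty_iff] at hE
    have h1 := (P i).total
    change ∑ x ∈ (P i).supp, (P i).mass x = 1 at h1
    rw [← Finset.sum_coe_sort (P i).supp fun x => (P i).mass x] at h1
    simp at h1
  let k₀ : (i : Fin N) → (P i).supp := fun i => (hne i).some
  -- the slack variables `t i` make the constraints of each `P_i` with `i ≠ i₀` independent of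
  -- those of `P_{i₀}`
  let g : ((Fin st.r → ℝ) × ({i : Fin N // i ≠ i₀} → ℝ)) →ₗ[ℝ]
      (((i : Fin N) × (P i).supp) → ℝ) :=
    { toFun := fun a x => (∑ l, if q l x.1 = x.2 then a.1 l else 0) +
        if h : x.1 ≠ i₀ then (if x.2 = k₀ x.1 then a.2 ⟨x.1, h⟩ else 0) else 0
      map_add' := by
        intro a b
        funext x
        have : ∀ l, (if q l x.1 = x.2 then (a + b).1 l else 0) =
            (if q l x.1 = x.2 then a.1 l else 0) + if q l x.1 = x.2 then b.1 l else 0 := by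
          intro l
          split_ifs <;> simp
        simp only [this, Finset.sum_add_distrib, Pi.add_apply]
        split_ifs <;> simp; ring
      map_smul' := by
        intro c a
        funext x
        simp only [Prod.smul_fst, Prod.smul_snd, Pi.smul_apply, smul_eq_mul, RingHom.id_apply,
          mul_add, Finset.mul_sum, mul_ite, mul_zero]
        split_ifs <;> simp }
  have hdim : Module.finrank ℝ (((i : Fin N) × (P i).supp) → ℝ) <
      Module.finrank ℝ ((Fin st.r → ℝ) × ({i : Fin N // i ≠ i₀} → ℝ)) := by
    have hc : Fintype.card {i : Fin N // i ≠ i₀} = N - 1 := by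
      simp
    rw [Module.finrank_prod, Module.finrank_fintype_fun_eq_card,
      Module.finrank_fintype_fun_eq_card, Module.finrank_fintype_fun_eq_card, hc,
      Fintype.card_sigma, Fintype.card_fin]
    simp only [Fintype.card_coe]
    zify [Nat.one_le_iff_ne_zero.2 hN.ne']
    linarith
  obtain ⟨a, ha, ha0⟩ :=
    (Submodule.ne_bot_iff _).1 (LinearMap.ker_ne_bot_of_finrank_lt (f := g) hdim)
  have hg : ∀ i k, (∑ l, if q l i = k then a.1 l else 0) +
      (if h : i ≠ i₀ then (if k = k₀ i then a.2 ⟨i, h⟩ else 0) else 0) = 0 := fun i k =>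
    congrFun (LinearMap.mem_ker.1 ha) ⟨i, k⟩
  have hsum : ∀ i, (∑ l, a.1 l) + (if h : i ≠ i₀ then a.2 ⟨i, h⟩ else 0) = 0 := by
    intro i
    have h1 := Finset.sum_congr rfl fun k (_ : k ∈ Finset.univ) => hg i k
    rw [Finset.sum_add_distrib, Finset.sum_comm] at h1
    split_ifs at h1 ⊢ <;> simpa using h1
  have ht : ∀ i (h : i ≠ i₀), a.2 ⟨i, h⟩ = 0 := by
    intro i h
    have h1 := hsum i
    have h2 := hsum i₀
    rw [dif_pos h] at h1
    rw [dif_neg (by simp)] at h2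
    linarith
  refine ha0 (Prod.ext (eq_zero_of_extreme hext hq fun i k => ?_) (funext fun i => ht i.1 i.2))
  have h1 := hg i k
  split_ifs at h1 with h2 h3
  · rwa [ht i h2, add_zero] at h1
  · rwa [add_zero] at h1
  · rwa [add_zero] at h1

/-! ### Couplings with discrete measures -/

theorem DiscreteMeasure.toMeasure_apply (Q : DiscreteMeasure d) (s : Set (E d)) :
    Q.toMeasure s = ∑ x ∈ Q.supp, ENNReal.ofReal (Q.mass x) * Measure.dirac x s := by
  simp [DiscreteMeasure.toMeasure, Measure.finsetSum_apply]

theorem DiscreteMeasure.toMeasure_singleton (Q : DiscreteMeasure d) (k : Q.supp) :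
    Q.toMeasure {(k : E d)} = ENNReal.ofReal (Q.mass k) := by
  rw [Q.toMeasure_apply, Finset.sum_eq_single (k : E d)]
  · simp
  · intro b _ hb
    simp [hb]
  · exact fun h => absurd k.2 h

theorem DiscreteMeasure.toMeasure_compl (Q : DiscreteMeasure d) :
    Q.toMeasure (Q.supp : Set (E d))ᶜ = 0 := by
  rw [Q.toMeasure_apply]
  refine Finset.sum_eq_zero fun x hx => ?_
  have : x ∉ (Q.supp : Set (E d))ᶜ := by simpa using hx
  rw [Measure.dirac_apply' _ Q.supp.finite_toSet.measurableSet.compl,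
    Set.indicator_of_notMem this, mul_zero]

instance (Q : DiscreteMeasure d) : IsProbabilityMeasure Q.toMeasure := by
  constructor
  rw [Q.toMeasure_apply]
  simp only [measure_univ, mul_one]
  rw [← ENNReal.ofReal_sum_of_nonneg fun x _ => Q.nonneg x]
  exact (congrArg ENNReal.ofReal Q.total).trans ENNReal.ofReal_one

/-- Disintegration of a coupling with a discrete measure: `p x k` is the conditional probability
of the support point `k` given `x`. -/
theorem exists_conditional (Q : DiscreteMeasure d) (π : Measure (E d × E d))
    [IsProbabilityMeasure π] (hπ : π.snd = Q.toMeasure) :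
    ∃ p : E d → Q.supp → ℝ, (∀ k, Measurable fun x => p x k) ∧ (∀ x k, 0 ≤ p x k) ∧
      (∀ x k, p x k ≤ 1) ∧ (∀ᵐ x ∂π.fst, ∑ k, p x k = 1) ∧
      (∀ k, ∫ x, p x k ∂π.fst = Q.mass k) ∧
      ∑ k : Q.supp, ∫⁻ x, ENNReal.ofReal (p x k) * edist x (k : E d) ^ 2 ∂π.fst ≤
        ∫⁻ z, edist z.1 z.2 ^ 2 ∂π := by
  set κ := π.condKernel
  have hdis : π.fst.compProd κ = π := π.disintegrate κ
  have hmeas : ∀ s : Set (E d), MeasurableSet s → ∫⁻ x, κ x s ∂π.fst = Q.toMeasure s := by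
    intro s hs
    have h1 := Measure.compProd_apply (μ := π.fst) (κ := κ) (measurable_snd hs)
    rw [hdis] at h1
    rw [← hπ, Measure.snd_apply hs, h1]
    rfl
  have hm : ∀ k : Q.supp, Measurable fun x => κ x {(k : E d)} := fun k =>
    κ.measurable_coe (measurableSet_singleton _)
  have hne : ∀ x s, κ x s ≠ ∞ := fun x s => measure_ne_top _ _
  refine ⟨fun x k => (κ x {(k : E d)}).toReal, fun k => (hm k).ennreal_toReal,
    fun x k => ENNReal.toReal_nonneg, fun x k => ?_, ?_, fun k => ?_, ?_⟩
  · exact ENNReal.toReal_le_of_le_ofReal zero_le_one (by simpa using prob_le_one)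
  · have hS := Q.supp.finite_toSet.measurableSet.compl
    have h0 : ∀ᵐ x ∂π.fst, κ x (Q.supp : Set (E d))ᶜ = 0 := by
      refine (lintegral_eq_zero_iff (κ.measurable_coe hS)).1 ?_
      rw [hmeas _ hS, Q.toMeasure_compl]
    filter_upwards [h0] with x hx
    rw [← ENNReal.toReal_sum fun k _ => hne x _,
      Finset.sum_coe_sort Q.supp fun k => κ x {k}, sum_measure_singleton,
      (prob_compl_eq_zero_iff Q.supp.finite_toSet.measurableSet).1 hx]
    rfl
  · rw [integral_toReal (hm k).aemeasurable (Filter.Eventually.of_forall fun x => (hne x _).lt_top),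
      hmeas _ (measurableSet_singleton _), Q.toMeasure_singleton,
      ENNReal.toReal_ofReal (Q.nonneg _)]
  · have hint : ∫⁻ z, edist z.1 z.2 ^ 2 ∂π = ∫⁻ x, ∫⁻ y, edist x y ^ 2 ∂κ x ∂π.fst := by
      conv_lhs => rw [← hdis]
      exact Measure.lintegral_compProd (by fun_prop)
    rw [hint, ← lintegral_finsetSum]
    · refine lintegral_mono fun x => ?_
      simp only [ENNReal.ofReal_toReal (hne x _)]
      calc ∑ k : Q.supp, κ x {(k : E d)} * edist x (k : E d) ^ 2
          = ∫⁻ y in Q.supp, edist x y ^ 2 ∂κ x := by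
            rw [lintegral_finset, ← Finset.sum_coe_sort Q.supp]
            exact Finset.sum_congr rfl fun k _ => mul_comm _ _
        _ ≤ _ := setLIntegral_le_lintegral _ _
    · intro k _
      have := hm k
      fun_prop

theorem W2_sq (μ ν : Measure (E d)) :
    W2 μ ν ^ 2 = ⨅ (π : Measure (E d × E d)) (_ : π.fst = μ ∧ π.snd = ν),
      ∫⁻ p, edist p.1 p.2 ^ 2 ∂π := by
  unfold W2
  rw [← ENNReal.rpow_natCast, ← ENNReal.rpow_mul]
  norm_num

/-- The objective is an infimum over families of couplings. -/
theorem le_phi (hpos : ∀ i, 0 < lam i) (hsum : ∑ i, lam i = 1) {μ : Measure (E d)} {K : ℝ≥0∞}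
    (h : ∀ π : Fin N → Measure (E d × E d),
      (∀ i, (π i).fst = μ ∧ (π i).snd = (P i).toMeasure) →
      K ≤ ∑ i, ENNReal.ofReal (lam i) * ∫⁻ z, edist z.1 z.2 ^ 2 ∂π i) :
    K ≤ phi P lam μ := by
  unfold phi
  by_cases htop : ∃ i, W2 μ (P i).toMeasure ^ 2 = ∞
  · obtain ⟨i, hi⟩ := htop
    have h1 : ENNReal.ofReal (lam i) * W2 μ (P i).toMeasure ^ 2 = ∞ := by
      rw [hi, ENNReal.mul_top (by simpa using hpos i)]
    have h2 := Finset.single_le_sum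
      (f := fun i => ENNReal.ofReal (lam i) * W2 μ (P i).toMeasure ^ 2)
      (fun i _ => zero_le) (Finset.mem_univ i)
    simp only [h1, top_le_iff] at h2
    rw [h2]
    exact le_top
  · push Not at htop
    refine ENNReal.le_of_forall_pos_le_add fun ε hε _ => ?_
    have hex : ∀ i, ∃ π : Measure (E d × E d), (π.fst = μ ∧ π.snd = (P i).toMeasure) ∧
        ∫⁻ z, edist z.1 z.2 ^ 2 ∂π ≤ W2 μ (P i).toMeasure ^ 2 + ε := by
      intro i
      have hlt : W2 μ (P i).toMeasure ^ 2 < W2 μ (P i).toMeasure ^ 2 + ε :=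
        ENNReal.lt_add_right (htop i) (by simpa using hε.ne')
      nth_rewrite 1 [W2_sq] at hlt
      simp only [iInf_lt_iff] at hlt
      obtain ⟨π, hπ, hlt⟩ := hlt
      exact ⟨π, hπ, hlt.le⟩
    choose π hπ hle using hex
    calc K ≤ _ := h π hπ
      _ ≤ ∑ i, ENNReal.ofReal (lam i) * (W2 μ (P i).toMeasure ^ 2 + ε) :=
        Finset.sum_le_sum fun i _ => mul_le_mul_right (hle i) _
      _ = _ := by
        simp_rw [mul_add]
        rw [Finset.sum_add_distrib, ← Finset.sum_mul,
          ← ENNReal.ofReal_sum_of_nonneg fun i _ => (hpos i).le, hsum, ENNReal.ofReal_one, one_mul]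

theorem phi_le (π : Fin N → Measure (E d × E d)) {μ : Measure (E d)}
    (hπ : ∀ i, (π i).fst = μ ∧ (π i).snd = (P i).toMeasure) :
    phi P lam μ ≤ ∑ i, ENNReal.ofReal (lam i) * ∫⁻ z, edist z.1 z.2 ^ 2 ∂π i := by
  refine Finset.sum_le_sum fun i _ => mul_le_mul_right ?_ _
  rw [W2_sq]
  exact iInf₂_le (π i) (hπ i)

theorem edist_sq_eq_ofReal (x y : E d) : edist x y ^ 2 = ENNReal.ofReal (‖x - y‖ ^ 2) := by
  rw [edist_dist, dist_eq_norm, ENNReal.ofReal_pow (norm_nonneg _)]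

theorem isProbabilityMeasure_of_fst {μ : Measure (E d)} [IsProbabilityMeasure μ]
    {π : Measure (E d × E d)} (h : π.fst = μ) : IsProbabilityMeasure π :=
  ⟨by rw [← Measure.fst_univ, h, measure_univ]⟩

theorem DiscreteMeasure.integral_eq (Q : DiscreteMeasure d) (f : E d → ℝ) :
    ∫ x, f x ∂Q.toMeasure = ∑ x : Q.supp, Q.mass x * f x := by
  unfold DiscreteMeasure.toMeasure
  have hint : ∀ x ∈ Q.supp, Integrable f (ENNReal.ofReal (Q.mass x) • Measure.dirac x) :=
    fun x _ => (integrable_dirac (by simp)).smul_measure ENNReal.ofReal_ne_top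
  rw [integral_finsetSum_measure hint, Finset.sum_coe_sort Q.supp fun x => Q.mass x * f x]
  refine Finset.sum_congr rfl fun x _ => ?_
  rw [integral_smul_measure, integral_dirac, ENNReal.toReal_ofReal (Q.nonneg x), smul_eq_mul]

theorem DiscreteMeasure.lintegral_eq (Q : DiscreteMeasure d) (f : E d → ℝ≥0∞) :
    ∫⁻ x, f x ∂Q.toMeasure = ∑ x : Q.supp, ENNReal.ofReal (Q.mass x) * f x := by
  unfold DiscreteMeasure.toMeasure
  rw [lintegral_finsetSum_measure,
    Finset.sum_coe_sort Q.supp fun x => ENNReal.ofReal (Q.mass x) * f x]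
  refine Finset.sum_congr rfl fun x _ => ?_
  rw [lintegral_smul_measure, lintegral_dirac, smul_eq_mul]

theorem DiscreteMeasure.mass_pos (Q : DiscreteMeasure d) (k : Q.supp) : 0 < Q.mass k :=
  lt_of_le_of_ne (Q.nonneg _) (Finsupp.mem_support_iff.1 k.2).symm

theorem DiscreteMeasure.ae_iff (Q : DiscreteMeasure d) {p : E d → Prop}
    (h : ∀ᵐ x ∂Q.toMeasure, p x) (k : Q.supp) : p k := by
  by_contra hk
  have h1 : Q.toMeasure {(k : E d)} ≤ Q.toMeasure {x | ¬ p x} :=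
    measure_mono (Set.singleton_subset_iff.2 hk)
  rw [MeasureTheory.ae_iff.1 h, Q.toMeasure_singleton, nonpos_iff_eq_zero,
    ENNReal.ofReal_eq_zero] at h1
  exact (Q.mass_pos k).not_ge h1

theorem ofReal_cost (hpos : ∀ i, 0 < lam i) {S₀ : Finset (E d)} {y : Plan P S₀}
    (hy : ∀ i j k, 0 ≤ y i j k) :
    ENNReal.ofReal (cost lam y) = ∑ i, ENNReal.ofReal (lam i) *
      ∑ j : S₀, ∑ k : (P i).supp, ENNReal.ofReal (y i j k) * edist (j : E d) (k : E d) ^ 2 := by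
  have h0 : ∀ i (j : S₀) (k : (P i).supp), 0 ≤ ‖(j : E d) - (k : E d)‖ ^ 2 * y i j k := fun i j k =>
    mul_nonneg (sq_nonneg _) (hy i j k)
  have h1 : ∀ i (j : S₀), 0 ≤ ∑ k : (P i).supp, ‖(j : E d) - (k : E d)‖ ^ 2 * y i j k := fun i j =>
    Finset.sum_nonneg fun k _ => h0 i j k
  have h2 : ∀ i, 0 ≤ ∑ j : S₀, ∑ k : (P i).supp, ‖(j : E d) - (k : E d)‖ ^ 2 * y i j k := fun i =>
    Finset.sum_nonneg fun j _ => h1 i j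
  unfold cost
  rw [ENNReal.ofReal_sum_of_nonneg fun i _ => mul_nonneg (hpos i).le (h2 i)]
  refine Finset.sum_congr rfl fun i _ => ?_
  rw [ENNReal.ofReal_mul (hpos i).le, ENNReal.ofReal_sum_of_nonneg fun j _ => h1 i j]
  congr 1
  refine Finset.sum_congr rfl fun j _ => ?_
  rw [ENNReal.ofReal_sum_of_nonneg fun k _ => h0 i j k]
  refine Finset.sum_congr rfl fun k _ => ?_
  rw [ENNReal.ofReal_mul (sq_nonneg _), edist_sq_eq_ofReal, mul_comm]

/-- For a discrete measure `Q`, every family of couplings comes from a transport. -/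
theorem le_phi_toMeasure (hpos : ∀ i, 0 < lam i) (hsum : ∑ i, lam i = 1)
    (Q : DiscreteMeasure d) {c : ℝ} (h : ∀ y : Plan P Q.supp, IsTransport P Q y → c ≤ cost lam y) :
    ENNReal.ofReal c ≤ phi P lam Q.toMeasure := by
  refine le_phi hpos hsum fun π hπ => ?_
  have hprob : ∀ i, IsProbabilityMeasure (π i) := fun i => isProbabilityMeasure_of_fst (hπ i).1
  choose p hpm hp0 hp1 hps hpi hpc using fun i => exists_conditional (P i) (π i) (hπ i).2
  simp only [fun i => (hπ i).1] at hps hpi hpc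
  set y : Plan P Q.supp := fun i j k => Q.mass j * p i j k with hy
  have hy0 : ∀ i j k, 0 ≤ y i j k := fun i j k => mul_nonneg (Q.nonneg _) (hp0 i _ k)
  have hyT : IsTransport P Q y := by
    refine ⟨fun i j => ?_, fun i k => ?_, hy0⟩
    · simp only [hy]
      rw [← Finset.mul_sum, Q.ae_iff (hps i) j, mul_one]
    · rw [← hpi i k, Q.integral_eq]
  refine (ENNReal.ofReal_le_ofReal (h y hyT)).trans ?_
  rw [ofReal_cost hpos hy0]
  refine Finset.sum_le_sum fun i _ => mul_le_mul_right (le_trans (le_of_eq ?_) (hpc i)) _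
  rw [Finset.sum_comm]
  refine Finset.sum_congr rfl fun k _ => ?_
  rw [Q.lintegral_eq]
  refine Finset.sum_congr rfl fun j _ => ?_
  simp only [hy]
  rw [ENNReal.ofReal_mul (Q.nonneg _), mul_assoc]

/-- A transport from a discrete measure induces couplings of the same cost. -/
theorem phi_toMeasure_le (hpos : ∀ i, 0 < lam i) (Q : DiscreteMeasure d) {y : Plan P Q.supp}
    (h : IsTransport P Q y) : phi P lam Q.toMeasure ≤ ENNReal.ofReal (cost lam y) := by
  rw [ofReal_cost hpos h.2.2]
  refine (phi_le (fun i => ∑ j : Q.supp, ∑ k : (P i).supp,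
    ENNReal.ofReal (y i j k) • Measure.dirac ((j : E d), (k : E d))) fun i => ⟨?_, ?_⟩).trans
    (le_of_eq ?_)
  · ext s hs
    rw [Measure.fst_apply hs, Q.toMeasure_apply, ← Finset.sum_coe_sort Q.supp]
    simp only [Measure.finsetSum_apply, Measure.smul_apply, smul_eq_mul]
    refine Finset.sum_congr rfl fun j _ => ?_
    rw [← h.1 i j, ENNReal.ofReal_sum_of_nonneg fun k _ => h.2.2 i j k, Finset.sum_mul]
    refine Finset.sum_congr rfl fun k _ => ?_
    rw [Measure.dirac_apply' _ (measurable_fst hs), Measure.dirac_apply' _ hs]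
    rfl
  · ext s hs
    rw [Measure.snd_apply hs, (P i).toMeasure_apply, ← Finset.sum_coe_sort (P i).supp]
    simp only [Measure.finsetSum_apply, Measure.smul_apply, smul_eq_mul]
    rw [Finset.sum_comm]
    refine Finset.sum_congr rfl fun k _ => ?_
    rw [← h.2.1 i k, ENNReal.ofReal_sum_of_nonneg fun j _ => h.2.2 i j k, Finset.sum_mul]
    refine Finset.sum_congr rfl fun j _ => ?_
    rw [Measure.dirac_apply' _ (measurable_snd hs), Measure.dirac_apply' _ hs]
    rfl
  · refine Finset.sum_congr rfl fun i _ => congrArg _ ?_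
    rw [lintegral_finsetSum_measure]
    refine Finset.sum_congr rfl fun j _ => ?_
    rw [lintegral_finsetSum_measure]
    refine Finset.sum_congr rfl fun k _ => ?_
    rw [lintegral_smul_measure, lintegral_dirac, smul_eq_mul]

/-! ### The original support points give a 2-approximation -/

/-- The mean squared distance of two independent random points is at most twice the mean squared
distance of one of them from any fixed point. -/
theorem sum_sum_mul_norm_sub_sq_le {ι : Type*} [Fintype ι] {w : ι → ℝ} (hw : ∑ a, w a = 1)
    (x : ι → E d) (s : E d) :
    ∑ a, ∑ b, w a * w b * ‖x a - x b‖ ^ 2 ≤ ∑ b, 2 * (w b * ‖s - x b‖ ^ 2) := by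
  have h1 : ∀ a, ∑ b, w a * w b * ‖x a - x b‖ ^ 2 =
      w a * ‖(∑ i, w i • x i) - x a‖ ^ 2 +
        w a * ∑ i, w i * ‖(∑ i, w i • x i) - x i‖ ^ 2 := by
    intro a
    rw [← mul_add, ← sum_mul_norm_sub_sq hw x (x a), Finset.mul_sum]
    exact Finset.sum_congr rfl fun b _ => by ring
  simp_rw [h1]
  rw [Finset.sum_add_distrib, ← Finset.sum_mul, hw, one_mul, ← Finset.mul_sum,
    sum_mul_norm_sub_sq hw x s]
  nlinarith [sq_nonneg ‖(∑ i, w i • x i) - s‖]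

/-- Given couplings of `μ` with the `P_i`, draw `x` from `μ` and then, independently, points from
the conditional distributions of the `P_i`. The mixture of the `P_i` with weights `λ_i` is
transported to each `P_j` by pairing the points drawn for `i` and for `j`. -/
theorem exists_feasible_unionSupp (hpos : ∀ i, 0 < lam i) (hsum : ∑ i, lam i = 1)
    {μ : Measure (E d)} [IsProbabilityMeasure μ] (π : Fin N → Measure (E d × E d))
    (hπ : ∀ i, (π i).fst = μ ∧ (π i).snd = (P i).toMeasure) :
    ∃ v ∈ lpFeasible P (unionSupp P), ENNReal.ofReal (cost lam v.2) ≤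
      2 * ∑ i, ENNReal.ofReal (lam i) * ∫⁻ z, edist z.1 z.2 ^ 2 ∂π i := by
  classical
  have hprob : ∀ i, IsProbabilityMeasure (π i) := fun i => isProbabilityMeasure_of_fst (hπ i).1
  choose p hpm hp0 hp1 hps hpi hpc using fun i => exists_conditional (P i) (π i) (hπ i).2
  simp only [fun i => (hπ i).1] at hps hpi hpc
  have hint : ∀ i j k l, Integrable (fun x => p i x k * p j x l) μ := by
    intro i j k l
    refine Integrable.of_bound ((hpm i k).mul (hpm j l)).aestronglyMeasurable 1
      (Filter.Eventually.of_forall fun x => ?_)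
    rw [Real.norm_of_nonneg (mul_nonneg (hp0 i x k) (hp0 j x l))]
    exact mul_le_one₀ (hp1 i x k) (hp0 j x l) (hp1 j x l)
  set D : ((i : Fin N) × (P i).supp) → (j : Fin N) → (P j).supp → ℝ :=
    fun a j k => lam a.1 * ∫ x, p a.1 x a.2 * p j x k ∂μ with hD
  set m : ((i : Fin N) × (P i).supp) → ℝ := fun a => lam a.1 * (P a.1).mass a.2 with hm
  have hfam : IsFamily P m D := by
    refine ⟨fun a j k => ?_, fun a j => ?_, fun j k => ?_⟩
    · exact mul_nonneg (hpos _).le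
        (integral_nonneg fun x => mul_nonneg (hp0 _ x _) (hp0 _ x _))
    · simp only [hD, hm]
      rw [← Finset.mul_sum, ← integral_finsetSum _ fun k _ => hint _ _ _ _, ← hpi]
      congr 1
      refine integral_congr_ae ?_
      filter_upwards [hps j] with x hx
      rw [← Finset.mul_sum, hx, mul_one]
    · simp only [hD]
      rw [Fintype.sum_sigma]
      have : ∀ i, ∑ s : (P i).supp, lam i * ∫ x, p i x s * p j x k ∂μ =
          lam i * (P j).mass k := by
        intro i
        rw [← Finset.mul_sum, ← integral_finsetSum _ fun k _ => hint _ _ _ _, ← hpi]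
        congr 1
        refine integral_congr_ae ?_
        filter_upwards [hps i] with x hx
        rw [← Finset.sum_mul, hx, one_mul]
      simp_rw [this]
      rw [← Finset.sum_mul, hsum, one_mul]
  obtain ⟨v, hv, -, hvc⟩ := hfam.exists_feasible (lam := lam) (fun a => (a.2 : E d)) (unionSupp P)
    fun a _ => Finset.mem_biUnion.2 ⟨a.1, Finset.mem_univ _, a.2.2⟩
  refine ⟨v, hv, ?_⟩
  rw [hvc]
  set w : E d → ((i : Fin N) × (P i).supp) → ℝ := fun x a => lam a.1 * p a.1 x a.2 with hw
  have hw0 : ∀ x a, 0 ≤ w x a := fun x a => mul_nonneg (hpos _).le (hp0 _ x _)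
  have hwint : ∀ a b : (i : Fin N) × (P i).supp, Integrable
      (fun x => w x a * w x b * ‖(a.2 : E d) - (b.2 : E d)‖ ^ 2) μ := by
    intro a b
    refine (((hint a.1 b.1 a.2 b.2).const_mul (lam a.1 * lam b.1)).mul_const
      (‖(a.2 : E d) - (b.2 : E d)‖ ^ 2)).congr (Filter.Eventually.of_forall fun x => ?_)
    simp only [hw]
    ring
  have hcost : famCost lam (fun a : (i : Fin N) × (P i).supp => (a.2 : E d)) D =
      ∫ x, ∑ a, ∑ b, w x a * w x b * ‖(a.2 : E d) - (b.2 : E d)‖ ^ 2 ∂μ := by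
    rw [integral_finsetSum _ fun a _ => integrable_finsetSum _ fun b _ => hwint a b]
    simp_rw [integral_finsetSum _ fun b _ => hwint _ b]
    unfold famCost
    simp_rw [Finset.mul_sum]
    rw [Finset.sum_comm]
    refine Finset.sum_congr rfl fun a _ => ?_
    rw [Fintype.sum_sigma]
    refine Finset.sum_congr rfl fun j _ => Finset.sum_congr rfl fun k _ => ?_
    simp only [hD]
    rw [integral_mul_const]
    have : ∀ x, w x a * w x ⟨j, k⟩ = (lam a.1 * lam j) * (p a.1 x a.2 * p j x k) := by
      intro x
      simp only [hw]
      ring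
    simp_rw [this]
    rw [integral_const_mul]
    ring
  rw [hcost, ofReal_integral_eq_lintegral_ofReal
    (integrable_finsetSum _ fun a _ => integrable_finsetSum _ fun b _ => hwint a b)
    (Filter.Eventually.of_forall fun x => Finset.sum_nonneg fun a _ => Finset.sum_nonneg
      fun b _ => mul_nonneg (mul_nonneg (hw0 x a) (hw0 x b)) (sq_nonneg _))]
  have hle : ∀ᵐ x ∂μ, ENNReal.ofReal
      (∑ a, ∑ b, w x a * w x b * ‖(a.2 : E d) - (b.2 : E d)‖ ^ 2) ≤
      ∑ i, 2 * (ENNReal.ofReal (lam i) *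
        ∑ k : (P i).supp, ENNReal.ofReal (p i x k) * edist x (k : E d) ^ 2) := by
    filter_upwards [ae_all_iff.2 hps] with x hx
    have hw1 : ∑ a, w x a = 1 := by
      simp only [hw]
      rw [Fintype.sum_sigma]
      simp_rw [← Finset.mul_sum, hx, mul_one, hsum]
    refine (ENNReal.ofReal_le_ofReal
      (sum_sum_mul_norm_sub_sq_le hw1 (fun a => (a.2 : E d)) x)).trans (le_of_eq ?_)
    rw [ENNReal.ofReal_sum_of_nonneg fun b _ =>
      mul_nonneg zero_le_two (mul_nonneg (hw0 x b) (sq_nonneg _)), Fintype.sum_sigma]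
    refine Finset.sum_congr rfl fun i _ => ?_
    rw [Finset.mul_sum, Finset.mul_sum]
    refine Finset.sum_congr rfl fun k _ => ?_
    simp only [hw]
    rw [ENNReal.ofReal_mul zero_le_two, ENNReal.ofReal_mul (mul_nonneg (hpos i).le (hp0 i x k)),
      ENNReal.ofReal_mul (hpos i).le, edist_sq_eq_ofReal, mul_assoc]
    norm_num
  refine (lintegral_mono_ae hle).trans ?_
  have hmeas : ∀ i (k : (P i).supp), Measurable fun x =>
      ENNReal.ofReal (p i x k) * edist x (k : E d) ^ 2 := by
    intro i k
    have := hpm i k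
    fun_prop
  rw [lintegral_finsetSum, Finset.mul_sum]
  · refine Finset.sum_le_sum fun i _ => ?_
    rw [lintegral_const_mul, lintegral_const_mul, lintegral_finsetSum]
    · exact mul_le_mul_right (mul_le_mul_right (hpc i) _) _
    all_goals fun_prop
  · fun_prop

/-! ### Invariants of the algorithm -/

/-- The optimal value of the linear program over `S₀` is at most `2 φ(μ)` for every `μ`. The
optimal value is expressed through its lower bounds `c`. -/
def IsTwoApprox (P : Fin N → DiscreteMeasure d) (lam : Fin N → ℝ) (S₀ : Finset (E d)) : Prop :=
  ∀ μ : Measure (E d), IsProbabilityMeasure μ → ∀ c : ℝ,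
    (∀ v ∈ lpFeasible P S₀, c ≤ cost lam v.2) → ENNReal.ofReal c ≤ 2 * phi P lam μ

theorem isTwoApprox_unionSupp (hpos : ∀ i, 0 < lam i) (hsum : ∑ i, lam i = 1) :
    IsTwoApprox P lam (unionSupp P) := by
  intro μ _ c hc
  have h2 : ENNReal.ofReal c / 2 ≤ phi P lam μ := by
    refine le_phi hpos hsum fun π hπ => ?_
    obtain ⟨v, hv, hvc⟩ := exists_feasible_unionSupp hpos hsum π hπ
    refine ENNReal.div_le_of_le_mul' ?_
    exact (ENNReal.ofReal_le_ofReal (hc v hv)).trans hvc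
  rw [mul_comm]
  exact (ENNReal.div_le_iff_le_mul (Or.inl two_ne_zero) (Or.inl ENNReal.ofNat_ne_top)).1 h2

theorem IsTwoApprox.mono {S S' : Finset (E d)} (h : IsTwoApprox P lam S) {v' : LPVar P S'}
    (hv' : v' ∈ lpFeasible P S') (hle : ∀ v ∈ lpFeasible P S, cost lam v'.2 ≤ cost lam v.2) :
    IsTwoApprox P lam S' :=
  fun μ hμ c hc => h μ hμ c fun v hv => (hc v' hv').trans (hle v hv)

/-- The independent couplings of some `P_i` with all the others. -/
theorem lpFeasible_unionSupp_nonempty (hN : 0 < N) : (lpFeasible P (unionSupp P)).Nonempty := by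
  have htot : ∀ i, ∑ k : (P i).supp, (P i).mass k = 1 := fun i => by
    rw [Finset.sum_coe_sort (P i).supp fun x => (P i).mass x]
    exact (P i).total
  have hfam : IsFamily P (fun a : (P ⟨0, hN⟩).supp => (P ⟨0, hN⟩).mass a)
      (fun a i k => (P ⟨0, hN⟩).mass a * (P i).mass k) := by
    refine ⟨fun a i k => mul_nonneg ((P _).nonneg _) ((P i).nonneg _), fun a i => ?_,
      fun i k => ?_⟩
    · rw [← Finset.mul_sum, htot, mul_one]
    · rw [← Finset.sum_mul, htot, one_mul]
  obtain ⟨v, hv, -⟩ := hfam.exists_feasible (lam := fun _ => 0) (fun a => (a : E d)) (unionSupp P)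
    fun a _ => Finset.mem_biUnion.2 ⟨_, Finset.mem_univ _, a.2⟩
  exact ⟨v, hv⟩

/-- The stage comes from an optimal vertex whose value is at most twice the minimum of `φ`. -/
structure IsGoodStage (lam : Fin N → ℝ) (st : Stage P) : Prop where
  optimal : IsOptimalVertex P lam st.S₀ st.sol
  twoApprox : IsTwoApprox P lam st.S₀

/-- The invariant of the algorithm. The alternative `A = st.parts ∨ HasImprovement lam st A` is
what forces a strict improvement of the cost as soon as the shift phase has made a move. -/
def Invariant (lam : Fin N → ℝ) : Config P → Prop
  | .solve S₀ => (lpFeasible P S₀).Nonempty ∧ IsTwoApprox P lam S₀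
  | .shift st todo A => IsGoodStage lam st ∧ (∀ p ∈ todo, p.2 ≠ p.1) ∧
      IsOptimalParts lam st A ∧ (A = st.parts ∨ HasImprovement lam st A)
  | .spread st todo A B => IsGoodStage lam st ∧ ∃ A₀ W, IsOptimalParts lam st A₀ ∧
      (A₀ = st.parts ∨ HasImprovement lam st A₀) ∧ IsSpread lam A₀ A B W ∧
      ∀ l ∉ todo, A.mass l = 0
  | .compare st P' => IsGoodStage lam st ∧ IterationResult lam st P'
  | .output S₀ P' => ∃ st : Stage P, st.S₀ = S₀ ∧ IsGoodStage lam st ∧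
      IterationResult lam st P' ∧ P' = st.org

theorem mem_loopPairs {r : ℕ} {p : Fin r × Fin r} (hp : p ∈ loopPairs r) : p.2 ≠ p.1 := by
  simp only [loopPairs, List.mem_flatMap, List.mem_map, List.mem_filter, decide_eq_true_eq] at hp
  obtain ⟨l, -, j, ⟨-, hj⟩, rfl⟩ := hp
  exact hj.ne

theorem Invariant.step (hpos : ∀ i, 0 < lam i) (hsum : ∑ i, lam i = 1) {C C' : Config P}
    (hC : Invariant lam C) (h : Step P lam C C') : Invariant lam C' := by
  have hN := pos_of_sum_eq_one hsum
  cases h with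
  | solve S₀ st hS h =>
    subst hS
    exact ⟨⟨h, hC.2⟩, fun p => mem_loopPairs, isOptimalParts_parts hN h.1.1, Or.inl rfl⟩
  | shiftEmpty st l j todo A h =>
    exact ⟨hC.1, fun p hp => hC.2.1 p (List.mem_cons_of_mem _ hp), hC.2.2⟩
  | shiftNext st l j todo A q h hq hc =>
    exact ⟨hC.1, fun p hp => hC.2.1 p (List.mem_cons_of_mem _ hp), hC.2.2⟩
  | shiftMove st l j todo A q h hq hc =>
    obtain ⟨h1, h2, h3, -⟩ := hC
    have hjl : j ≠ l := h2 (l, j) List.mem_cons_self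
    exact ⟨h1, h2, h3.shiftMove hN hsum (fun i => (hq i).1) hc,
      Or.inr (hasImprovement_shiftMove h3 hN hjl (fun i => (hq i).1) hc)⟩
  | shiftEnd st A =>
    obtain ⟨h1, -, h3, h4⟩ := hC
    exact ⟨h1, A, fun _ _ => 0, h3, h4, isSpread_start h3.family,
      fun l hl => absurd (List.mem_finRange l) hl⟩
  | spreadEmpty st l todo A B h =>
    obtain ⟨h1, A₀, W, h2, h3, h4, h5⟩ := hC
    refine ⟨h1, A₀, W, h2, h3, h4, fun l' hl' => ?_⟩
    by_cases hl : l' = l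
    · subst hl
      refine le_antisymm (not_lt.1 h) ?_
      rw [← h4.row l' ⟨0, hN⟩]
      exact Finset.sum_nonneg fun k _ => h4.nonneg _ _ _
    · exact h5 l' (by simp [hl, hl'])
  | spreadMove st l todo A B q h hq =>
    obtain ⟨h1, A₀, W, h2, h3, h4, h5⟩ := hC
    refine ⟨h1, A₀, _, h2, h3, h4.spreadMove hN hpos hq, fun l' hl' => ?_⟩
    have hl : l' ≠ l := fun h => hl' (h ▸ List.mem_cons_self)
    rw [Parts.addMass_mass, h5 l' hl', if_neg hl, add_zero]
  | spreadEnd st A B =>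
    obtain ⟨h1, A₀, W, h2, h3, h4, h5⟩ := hC
    exact ⟨h1, h4.iterationResult hN hsum h1.optimal h2 h3 fun l => h5 l List.not_mem_nil⟩
  | again st P' h =>
    obtain ⟨h1, h2⟩ := hC
    obtain ⟨v, hv, hle, -⟩ := h2.improve
    exact ⟨⟨v, hv⟩, h1.twoApprox.mono hv fun w hw => hle.trans (h1.optimal.2 w hw)⟩
  | finish st P' h => exact ⟨st, rfl, hC.1, hC.2, h⟩

theorem Reachable.invariant (hpos : ∀ i, 0 < lam i) (hsum : ∑ i, lam i = 1) {C : Config P}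
    (h : Reachable P lam C) : Invariant lam C := by
  induction h with
  | refl =>
    exact ⟨lpFeasible_unionSupp_nonempty (pos_of_sum_eq_one hsum),
      isTwoApprox_unionSupp hpos hsum⟩
  | tail _ h ih => exact ih.step hpos hsum h

/-! ### Termination -/

/-- A simultaneous choice of maximizers over the support points of the partial measures; this
serves both for the argmax of the shift phase and for the lexicographic maximum of the spread
phase. -/
theorem exists_forall_max {ι : Type*} [LinearOrder ι] {r : ℕ} {A : Parts P r} {l : Fin r}
    (h : ∀ i, ∃ k, 0 < A.D l i k) (f : E d → ι) :
    ∃ q : Selection P, ∀ i, 0 < A.D l i (q i) ∧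
      ∀ k : (P i).supp, 0 < A.D l i k → f k ≤ f (q i) := by
  have : ∀ i, ∃ k₀ : (P i).supp, 0 < A.D l i k₀ ∧
      ∀ k : (P i).supp, 0 < A.D l i k → f k ≤ f k₀ := by
    intro i
    obtain ⟨k₀, hk₀, hmax⟩ := Set.exists_max_image {k | 0 < A.D l i k}
      (fun k : (P i).supp => f k) (Set.toFinite _) (h i)
    exact ⟨k₀, hk₀, hmax⟩
  choose q hq using this
  exact ⟨q, hq⟩

theorem exists_pos_of_row {r : ℕ} {A : Parts P r} {l : Fin r}
    (hrow : ∀ i, ∑ k, A.D l i k = A.mass l) (hl : 0 < A.mass l) (i : Fin N) :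
    ∃ k, 0 < A.D l i k := by
  by_contra! hc
  have := Finset.sum_nonpos fun k (_ : k ∈ Finset.univ) => hc k
  rw [hrow i] at this
  exact hl.not_ge this

/-- A run that has not returned a measure can be continued. -/
theorem Invariant.progress (hsum : ∑ i, lam i = 1) {C : Config P} (hC : Invariant lam C) :
    (∃ S₀ P', C = .output S₀ P') ∨ ∃ C', Step P lam C C' := by
  have hN := pos_of_sum_eq_one hsum
  match C, hC with
  | .solve S₀, hC =>
    obtain ⟨v, hv⟩ := exists_isOptimalVertex (lam := lam) hN hC.1
    classical
    exact Or.inr ⟨_, Step.solve S₀ ⟨S₀, v, _, (Fintype.equivFin _).symm⟩ rfl hv⟩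
  | .shift st [] A, _ => exact Or.inr ⟨_, Step.shiftEnd st A⟩
  | .shift st ((l, j) :: todo) A, hC =>
    right
    by_cases h : 0 < A.mass l
    · obtain ⟨q, hq⟩ := exists_forall_max (hC.2.2.1.family.exists_pos h)
        fun x => inner ℝ (st.point j - st.point l) x
      by_cases hc : ‖centroid lam q - st.point j‖ ^ 2 = ‖centroid lam q - st.point l‖ ^ 2
      · exact ⟨_, Step.shiftMove st l j todo A q h hq hc⟩
      · exact ⟨_, Step.shiftNext st l j todo A q h hq hc⟩
    · exact ⟨_, Step.shiftEmpty st l j todo A h⟩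
  | .spread st [] A B, _ => exact Or.inr ⟨_, Step.spreadEnd st A B⟩
  | .spread st (l :: todo) A B, hC =>
    right
    obtain ⟨-, A₀, W, -, -, h4, -⟩ := hC
    by_cases h : 0 < A.mass l
    · obtain ⟨q, hq⟩ := exists_forall_max (exists_pos_of_row (h4.row l) h)
        fun x => toLex (WithLp.ofLp x)
      exact ⟨_, Step.spreadMove st l todo A B q h hq⟩
    · exact ⟨_, Step.spreadEmpty st l todo A B h⟩
  | .compare st P', _ =>
    right
    by_cases h : P' = st.org
    · exact ⟨_, Step.finish st P' h⟩
    · exact ⟨_, Step.again st P' h⟩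
  | .output S₀ P', _ => exact Or.inl ⟨S₀, P', rfl⟩

/-- The linear program over `T` has a smaller optimal value than the one over `S`. -/
def IsBetter (P : Fin N → DiscreteMeasure d) (lam : Fin N → ℝ) (T S : Finset (E d)) : Prop :=
  ∃ w ∈ lpFeasible P T, ∀ v ∈ lpFeasible P S, cost lam w.2 < cost lam v.2

open Classical in
/-- The number of sets of weighted centroids that are better than `S`. -/
noncomputable def numBetter (P : Fin N → DiscreteMeasure d) (lam : Fin N → ℝ)
    (S : Finset (E d)) : ℕ :=
  ((Finset.univ.image fun q : Selection P => centroid lam q).powerset.filter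
    fun T => IsBetter P lam T S).card

theorem numBetter_lt {S S' : Finset (E d)} (h : IsBetter P lam S' S)
    (hS' : ∀ x ∈ S', ∃ q : Selection P, centroid lam q = x) :
    numBetter P lam S' < numBetter P lam S := by
  classical
  obtain ⟨w, hw, hlt⟩ := h
  unfold numBetter
  refine Finset.card_lt_card ((Finset.ssubset_iff_of_subset fun T hT => ?_).2 ⟨S', ?_, ?_⟩)
  · rw [Finset.mem_filter] at hT ⊢
    obtain ⟨hT, u, hu, hlt'⟩ := hT
    exact ⟨hT, u, hu, fun v hv => (hlt' w hw).trans (hlt v hv)⟩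
  · rw [Finset.mem_filter, Finset.mem_powerset]
    exact ⟨fun x hx => by simpa using hS' x hx, w, hw, hlt⟩
  · rw [Finset.mem_filter]
    rintro ⟨-, u, hu, hlt'⟩
    exact lt_irrefl _ (hlt' u hu)

/-- The termination measure: the number of better sets of centroids, the phase of the iteration,
the length of the list of pairs or indices still to be treated, and the number of support points
left in the part treated now. -/
noncomputable def rank (lam : Fin N → ℝ) : Config P → ℕ ×ₗ ℕ ×ₗ ℕ ×ₗ ℕ
  | .solve S₀ => toLex (numBetter P lam S₀, toLex (4, toLex (0, 0)))
  | .shift st [] _ => toLex (numBetter P lam st.S₀, toLex (3, toLex (0, 0)))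
  | .shift st (p :: todo) A =>
      toLex (numBetter P lam st.S₀, toLex (3, toLex (todo.length + 1, A.numPos p.1)))
  | .spread st [] _ _ => toLex (numBetter P lam st.S₀, toLex (2, toLex (0, 0)))
  | .spread st (l :: todo) A _ =>
      toLex (numBetter P lam st.S₀, toLex (2, toLex (todo.length + 1, A.numPos l)))
  | .compare st _ => toLex (numBetter P lam st.S₀, toLex (1, toLex (0, 0)))
  | .output S₀ _ => toLex (numBetter P lam S₀, toLex (0, toLex (0, 0)))

theorem rank_lt_of_step (hsum : ∑ i, lam i = 1) {C C' : Config P} (hC : Invariant lam C)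
    (h : Step P lam C C') : rank lam C' < rank lam C := by
  have hN := pos_of_sum_eq_one hsum
  cases h with
  | solve S₀ st hS h =>
    subst hS
    cases hp : loopPairs st.r <;> simp [rank, Prod.Lex.toLex_lt_toLex]
  | shiftEmpty st l j todo A h =>
    cases todo <;> simp [rank, Prod.Lex.toLex_lt_toLex]
  | shiftNext st l j todo A q h hq hc =>
    cases todo <;> simp [rank, Prod.Lex.toLex_lt_toLex]
  | shiftMove st l j todo A q h hq hc =>
    have hjl : j ≠ l := hC.2.1 (l, j) List.mem_cons_self
    have h1 := Parts.numPos_removeMin_lt hC.2.2.1.family.nonneg hN fun i => (hq i).1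
    rw [← Parts.numPos_congr (A := A.addMass l q (-A.minMass l q))
      (A' := (A.addMass l q (-A.minMass l q)).addMass j q (A.minMass l q)) fun i k => by
        rw [Parts.addMass_D _ j, if_neg fun h => hjl h.1.symm, add_zero]] at h1
    simpa [rank, Prod.Lex.toLex_lt_toLex] using h1
  | shiftEnd st A =>
    cases List.finRange st.r <;> simp [rank, Prod.Lex.toLex_lt_toLex]
  | spreadEmpty st l todo A B h =>
    cases todo <;> simp [rank, Prod.Lex.toLex_lt_toLex]
  | spreadMove st l todo A B q h hq =>
    obtain ⟨-, A₀, W, -, -, h4, -⟩ := hC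
    have h1 := Parts.numPos_removeMin_lt h4.nonneg hN fun i => (hq i).1
    simpa [rank, Prod.Lex.toLex_lt_toLex] using h1
  | spreadEnd st A B => simp [rank, Prod.Lex.toLex_lt_toLex]
  | again st P' h =>
    obtain ⟨h1, h2⟩ := hC
    obtain ⟨v, hv, -, hlt⟩ := h2.improve
    have := numBetter_lt (lam := lam) (S := st.S₀)
      ⟨v, hv, fun w hw => (hlt h).trans_le (h1.optimal.2 w hw)⟩ h2.support
    simp [rank, Prod.Lex.toLex_lt_toLex, this]
  | finish st P' h => simp [rank, Prod.Lex.toLex_lt_toLex]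

theorem terminates (hpos : ∀ i, 0 < lam i) (hsum : ∑ i, lam i = 1) : Terminates P lam := by
  refine ⟨?_, fun C hC => (hC.invariant hpos hsum).progress hsum⟩
  rintro ⟨C, h0, hstep⟩
  have hreach : ∀ n, Reachable P lam (C n) := by
    intro n
    induction n with
    | zero => rw [h0]; exact Relation.ReflTransGen.refl
    | succ n ih => exact ih.tail (hstep n)
  obtain ⟨n, hn⟩ := WellFounded.not_rel_apply_succ (r := (· < ·)) fun n => rank lam (C n)
  exact hn (rank_lt_of_step hsum ((hreach n).invariant hpos hsum) (hstep n))

/-! ### The returned measure -/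

theorem mem_org_support {st : Stage P} (hN : 0 < N) (h : st.sol ∈ lpFeasible P st.S₀) {x : E d} :
    x ∈ st.org.support ↔ ∃ l, st.point l = x := by
  constructor
  · intro hx
    have hxS := st.org_support_subset hx
    have h1 : 0 < st.sol.1 ⟨x, hxS⟩ := by
      refine lt_of_le_of_ne ((mem_lpFeasible_iff.1 h).mass_nonneg hN _) fun h0 => ?_
      exact Finsupp.mem_support_iff.1 hx ((st.org_apply ⟨x, hxS⟩).trans h0.symm)
    exact ⟨st.s.symm ⟨_, h1⟩, by simp [Stage.point]⟩
  · rintro ⟨l, rfl⟩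
    rw [Finsupp.mem_support_iff, Stage.point, st.org_apply]
    exact (st.s l).2.ne'

/-- The measure represented by a feasible solution. -/
noncomputable def Stage.orgMeasure (st : Stage P) (hN : 0 < N)
    (h : st.sol ∈ lpFeasible P st.S₀) : DiscreteMeasure d where
  mass := st.org
  nonneg x := by
    by_cases hx : x ∈ st.S₀
    · rw [st.org_apply ⟨x, hx⟩]
      exact (mem_lpFeasible_iff.1 h).mass_nonneg hN _
    · rw [Finsupp.notMem_support_iff.1 fun h => hx (st.org_support_subset h)]
  total := by
    rw [← (mem_lpFeasible_iff.1 h).sum_mass hN,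
      Finset.sum_subset st.org_support_subset fun x _ hx => Finsupp.notMem_support_iff.1 hx,
      ← Finset.sum_coe_sort st.S₀]
    exact Finset.sum_congr rfl fun j _ => st.org_apply j

/-- The transport from the represented measure that is part of the solution. -/
def Stage.orgPlan (st : Stage P) (hN : 0 < N) (h : st.sol ∈ lpFeasible P st.S₀) :
    Plan P (st.orgMeasure hN h).supp :=
  fun i j k => st.sol.2 i ⟨j, st.org_support_subset j.2⟩ k

section Org

variable {st : Stage P} (hN : 0 < N) (h : st.sol ∈ lpFeasible P st.S₀)

theorem Stage.sum_org_support_eq (f : st.S₀ → ℝ) (hf : ∀ j, st.sol.1 j = 0 → f j = 0) :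
    ∑ j : (st.orgMeasure hN h).supp, f ⟨j, st.org_support_subset j.2⟩ = ∑ j, f j := by
  refine Fintype.sum_of_injective
    (fun j : (st.orgMeasure hN h).supp => (⟨j, st.org_support_subset j.2⟩ : st.S₀))
    (fun a b hab => Subtype.ext (congrArg (fun x : st.S₀ => (x : E d)) hab)) _ _ (fun j hj => ?_)
    fun _ => rfl
  refine hf j ?_
  by_contra hne
  refine hj ⟨⟨j, Finsupp.mem_support_iff.2 ?_⟩, rfl⟩
  change st.org j ≠ 0
  rwa [st.org_apply]

theorem isTransport_orgPlan : IsTransport P (st.orgMeasure hN h) (st.orgPlan hN h) := by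
  have hF := mem_lpFeasible_iff.1 h
  refine ⟨fun i j => ?_, fun i k => ?_, fun i j k => hF.nonneg _ i k⟩
  · exact (hF.row _ i).trans (st.org_apply ⟨j, st.org_support_subset j.2⟩).symm
  · rw [← hF.col i k]
    exact Stage.sum_org_support_eq hN h (fun j => st.sol.2 i j k) fun j hj => hF.eq_zero hj i k

theorem cost_orgPlan : cost lam (st.orgPlan hN h) = cost lam st.sol.2 := by
  have hF := mem_lpFeasible_iff.1 h
  unfold cost
  refine Finset.sum_congr rfl fun i _ => congrArg _ ?_
  exact Stage.sum_org_support_eq hN h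
    (fun j => ∑ k : (P i).supp, ‖(j : E d) - k‖ ^ 2 * st.sol.2 i j k)
    fun j hj => Finset.sum_eq_zero fun k _ => by rw [hF.eq_zero hj, mul_zero]

theorem nonMassSplitting_orgPlan
    (hq : ∀ l, ∃ q : Selection P, ∀ i k, k ≠ q i → st.sol.2 i (st.s l).1 k = 0) :
    NonMassSplitting (st.orgMeasure hN h) (st.orgPlan hN h) := by
  intro i j
  have hF := mem_lpFeasible_iff.1 h
  obtain ⟨l, hl⟩ := (mem_org_support hN h).1 j.2
  obtain ⟨q, hq⟩ := hq l
  have hj : (⟨j, st.org_support_subset j.2⟩ : st.S₀) = (st.s l).1 := Subtype.ext hl.symm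
  have h0 : ∀ k, k ≠ q i → st.orgPlan hN h i j k = 0 := fun k hk => by
    unfold Stage.orgPlan
    rw [hj]
    exact hq i k hk
  have hmass : (st.orgMeasure hN h).mass j = st.sol.1 (st.s l).1 := by
    rw [← hj]
    exact st.org_apply ⟨j, st.org_support_subset j.2⟩
  have hval : st.orgPlan hN h i j (q i) = (st.orgMeasure hN h).mass j := by
    rw [← (isTransport_orgPlan hN h).1 i j,
      Finset.sum_eq_single (q i) (fun k _ hk => h0 k hk) (by simp)]
  refine ⟨q i, ⟨hval, h0⟩, fun k hk => ?_⟩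
  by_contra hne
  have h1 := hk.1
  rw [h0 k hne, hmass] at h1
  exact (st.s l).2.ne h1

theorem card_org_supp : (st.orgMeasure hN h).supp.card = st.r := by
  classical
  have : (st.orgMeasure hN h).supp = Finset.univ.image st.point := by
    ext x
    rw [Finset.mem_image]
    simp only [Finset.mem_univ, true_and]
    exact mem_org_support hN h
  rw [this, Finset.card_image_of_injective _ st.point_injective, Finset.card_univ,
    Fintype.card_fin]

end Org

/-- Every transport from a measure supported in `S₀` costs at least the optimal value. -/
theorem IsOptimalVertex.cost_le {S₀ : Finset (E d)} {v : LPVar P S₀}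
    (hv : IsOptimalVertex P lam S₀ v) {Q : DiscreteMeasure d} (hQ : Q.supp ⊆ S₀)
    {y : Plan P Q.supp} (hy : IsTransport P Q y) : cost lam v.2 ≤ cost lam y := by
  obtain ⟨w, hw, -, hwc⟩ := (isTransport_iff.1 hy).exists_feasible (lam := lam)
    (fun j => (j : E d)) S₀ fun j _ => hQ j.2
  rw [cost_eq_famCost y, ← hwc]
  exact hv.2 w hw

/-- The properties of a measure that an iteration has left unchanged. -/
theorem output_spec (hpos : ∀ i, 0 < lam i) (hsum : ∑ i, lam i = 1) {st : Stage P}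
    (hst : IsGoodStage lam st) (hres : IterationResult lam st st.org) :
    ∃ Q : DiscreteMeasure d, Q.mass = st.org ∧
      IsApproxBarycenter P lam st.S₀ Q ∧
      (Q.supp : Set (E d)) ⊆ centroidSet P lam ∧
      (∀ Pbar : Measure (E d), IsBarycenter P lam Pbar →
        phi P lam Q.toMeasure ≤ 2 * phi P lam Pbar) ∧
      (∃ y : Plan P Q.supp, IsOptimalTransport P lam Q y ∧ NonMassSplitting Q y ∧
        ENNReal.ofReal (cost lam y) = phi P lam Q.toMeasure) ∧
      (Q.supp.card : ℤ) ≤ (∑ i, ((P i).supp.card : ℤ)) - N + 1 := by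
  have hN := pos_of_sum_eq_one hsum
  have hf := hst.optimal.1.1
  have hT := isTransport_orgPlan hN hf
  have hsub : (st.orgMeasure hN hf).supp ⊆ st.S₀ := st.org_support_subset
  have hlow : ∀ Q : DiscreteMeasure d, Q.supp ⊆ st.S₀ →
      ENNReal.ofReal (cost lam st.sol.2) ≤ phi P lam Q.toMeasure := fun Q hQ =>
    le_phi_toMeasure hpos hsum Q fun y hy => hst.optimal.cost_le hQ hy
  have hphi : phi P lam (st.orgMeasure hN hf).toMeasure = ENNReal.ofReal (cost lam st.sol.2) :=
    le_antisymm (cost_orgPlan (lam := lam) hN hf ▸ phi_toMeasure_le hpos _ hT) (hlow _ hsub)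
  have hns : ∀ l, ∃ q : Selection P, ∀ i k, k ≠ q i → st.sol.2 i (st.s l).1 k = 0 := fun l =>
    (hres.nonSplitting rfl l).imp fun q hq => hq.2
  refine ⟨st.orgMeasure hN hf, rfl, ⟨hsub, fun Q' hQ' => hphi.trans_le (hlow Q' hQ')⟩,
    fun x hx => ?_, fun μ hμ => ?_, ⟨st.orgPlan hN hf, ⟨hT, fun y hy => ?_⟩,
      nonMassSplitting_orgPlan hN hf hns, ?_⟩, ?_⟩
  · obtain ⟨q, rfl⟩ := hres.support x hx
    exact ⟨fun i => q i, fun i => (q i).2, rfl⟩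
  · rw [hphi]
    exact hst.twoApprox μ hμ.1.1 _ hst.optimal.2
  · rw [cost_orgPlan]
    exact hst.optimal.cost_le hsub hy
  · rw [cost_orgPlan, hphi]
  · rw [card_org_supp]
    exact card_le_of_nonSplitting hN hst.optimal.1 hns

end DiscreteBarycenter

open DiscreteBarycenter in
theorem mainTheorem3 {N d : ℕ} (P : Fin N → DiscreteMeasure d) (lam : Fin N → ℝ)
    (hpos : ∀ i, 0 < lam i) (hsum : ∑ i, lam i = 1) :
    Terminates P lam ∧
    ∀ (S₀ : Finset (E d)) (P' : E d →₀ ℝ), Reachable P lam (.output S₀ P') →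
      ∃ Q : DiscreteMeasure d, Q.mass = P' ∧
        IsApproxBarycenter P lam S₀ Q ∧
        (Q.supp : Set (E d)) ⊆ centroidSet P lam ∧
        (∀ Pbar : Measure (E d), IsBarycenter P lam Pbar →
          phi P lam Q.toMeasure ≤ 2 * phi P lam Pbar) ∧
        (∃ y : Plan P Q.supp, IsOptimalTransport P lam Q y ∧ NonMassSplitting Q y ∧
          ENNReal.ofReal (cost lam y) = phi P lam Q.toMeasure) ∧
        (Q.supp.card : ℤ) ≤ (∑ i, ((P i).supp.card : ℤ)) - N + 1 := by
  refine ⟨terminates hpos hsum, fun S₀ P' hreach => ?_⟩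
  obtain ⟨st, rfl, hst, hres, rfl⟩ := hreach.invariant hpos hsum
  exact output_spec hpos hsum hst hres
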